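/- Let $m\ge 2$ and $q\ge 2$ be integers, and let $\Sigma_m=\{0,\dots,m-1\}^{\mathbb N}$ be the space of sequences $(x_k)_{k\ge 1}$ with the metric $\varrho(x,y)=m^{-\min\{n:\,x_n\ne y_n\}+1}$ for $x\neq y$, and $\varrho(x,x)=0$. Let $\Omega\subset\Sigma_m$ be a non-empty closed set and put $$X_\Omega=\{(x_k)_{k\ge1}\in\Sigma_m:\ (x_{iq^\ell})_{\ell\ge 0}\in\Omega\ \text{ for all } i\ge 1 \text{ with } q\nmid i\}.$$ For $k\ge 0$ let $\mathrm{Pref}_k(\Omega)$ be the set of words $u\in\{0,\dots,m-1\}^k$ that are the initial segment of some element of $\Omega$. The tree of prefixes $\Gamma(\Omega)$ is the directed graph with vertex set $V=\bigcup_{k\ge0}\mathrm{Pref}_k(\Omega)$ and an edge from $u$ to $v$ whenever $v=ui\in V$ for a single letter $i$; its root is the empty word $\varnothing$. Then: There is exactly one vector $\overline t=(t_v)_{v\in V}\in[1,m^{1/(q-1)}]^V$ such that $t_v^q=\sum_{w:\,vw\text{ is an edge}}t_w$ for every $v\in V$, and with this $\overline t$: (i) the Hausdorff dimension of $X_\Omega$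 is $$\dim_H(X_\Omega)=(q-1)\log_m t_\varnothing ;$$ (ii) the Minkowski (box-counting) dimension of $X_\Omega$ exists and is $$\dim_M(X_\Omega)=(q-1)^2\sum_{k=1}^\infty\frac{\log_m|\mathrm{Pref}_k(\Omega)|}{q^{k+1}},$$ where the series converges. Moreover $\dim_H(X_\Omega)=\dim_M(X_\Omega)$ if and only if $\Gamma(\Omega)$ is spherically symmetric, i.e. for every $k\ge 0$ all words in $\mathrm{Pref}_k(\Omega)$ have the same number of continuations in $\mathrm{Pref}_{k+1}(\Omega)$. -/

import Mathlib

open Filter Topology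
open scoped ENNReal NNReal

noncomputable section

/-- The symbolic space `Σ_m = {0, …, m-1}^ℕ` of sequences `(x_1, x_2, x_3, …)`. Positions are shifted
by one: the `k`-th term `x_k`, `k ≥ 1`, of the sequence is `x (k - 1)`. -/
def SymbolicSpace (m : ℕ) : Type := ℕ → Fin m

namespace SymbolicSpace

variable {m : ℕ}

/-- The distance on `Σ_m`: `ϱ(x, y) = m ^ (-min {n ≥ 1 : x_n ≠ y_n} + 1)` for `x ≠ y`, and
`ϱ(x, x) = 0`. Because of the shift of positions by one, `PiNat.firstDiff x y` is the least `n ≥ 1`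
with `x_n ≠ y_n`, minus one. -/
def rho (x y : SymbolicSpace m) : ℝ :=
  open Classical in
  if x = y then 0 else ((m : ℝ)⁻¹) ^ PiNat.firstDiff (E := fun _ => Fin m) x y

theorem rho_ultra (x y z : SymbolicSpace m) : rho x z ≤ max (rho x y) (rho y z) := by
  unfold rho
  by_cases hxz : x = z
  · rw [if_pos hxz]
    apply le_max_of_le_left
    split_ifs <;> positivity
  by_cases hxy : x = y
  · subst hxy; simp
  by_cases hyz : y = z
  · subst hyz; simp
  rw [if_neg hxz, if_neg hxy, if_neg hyz]
  have h0 : (0 : ℝ) ≤ (m : ℝ)⁻¹ := by positivity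
  have h1 : (m : ℝ)⁻¹ ≤ 1 := by
    rcases Nat.eq_zero_or_pos m with h | h
    · simp [h]
    · exact inv_le_one_of_one_le₀ (by exact_mod_cast h)
  have h := PiNat.min_firstDiff_le (E := fun _ => Fin m) x y z hxz
  rcases min_le_iff.1 h with h | h
  · exact le_max_of_le_left (pow_le_pow_of_le_one h0 h1 h)
  · exact le_max_of_le_right (pow_le_pow_of_le_one h0 h1 h)

theorem rho_nonneg (x y : SymbolicSpace m) : 0 ≤ rho x y := by
  unfold rho
  split_ifs <;> positivity

instance : MetricSpace (SymbolicSpace m) where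
  dist := rho
  dist_self x := by simp [rho]
  dist_comm x y := by
    unfold rho
    rw [PiNat.firstDiff_comm (E := fun _ => Fin m) x y]
    by_cases h : x = y
    · rw [if_pos h, if_pos h.symm]
    · rw [if_neg h, if_neg (Ne.symm h)]
  dist_triangle x y z :=
    (rho_ultra x y z).trans (max_le_add_of_nonneg (rho_nonneg x y) (rho_nonneg y z))
  eq_of_dist_eq_zero := by
    intro x y h
    by_contra hxy
    have hm : (m : ℝ) ≠ 0 := by
      have h0 : 0 < m := (Nat.zero_le _).trans_lt (x 0).isLt
      exact_mod_cast h0.ne'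
    change rho x y = 0 at h
    rw [rho, if_neg hxy] at h
    exact pow_ne_zero _ (inv_ne_zero hm) h

/-- The cylinder set `[u]`: all sequences that start with the finite word `u`. -/
def cylinder (u : List (Fin m)) : Set (SymbolicSpace m) :=
  {x | ∀ (i : ℕ) (hi : i < u.length), x i = u[i]}

/-- `X_Ω`: the sequences `(x_k)_{k ≥ 1}` such that `(x_{i q^ℓ})_{ℓ ≥ 0}` lies in `Ω` for every
positive integer `i` that `q` does not divide. -/
def multiplicativeSubshift (q : ℕ) (Ω : Set (SymbolicSpace m)) : Set (SymbolicSpace m) :=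
  {x | ∀ i : ℕ, 1 ≤ i → ¬ q ∣ i → (fun ℓ : ℕ => x (i * q ^ ℓ - 1)) ∈ Ω}

/-- `Pref_k(Ω)`: the words `u` of length `k` with `Ω ∩ [u] ≠ ∅`. -/
def prefixesOfLength (Ω : Set (SymbolicSpace m)) (k : ℕ) : Set (List (Fin m)) :=
  {u | u.length = k ∧ (Ω ∩ cylinder u).Nonempty}

/-- `Pref(Ω)`: all finite prefixes of elements of `Ω`, including the empty word. -/
def prefixes (Ω : Set (SymbolicSpace m)) : Set (List (Fin m)) :=
  ⋃ k, prefixesOfLength Ω k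

theorem nil_mem_prefixes {Ω : Set (SymbolicSpace m)} (hΩ : Ω.Nonempty) :
    [] ∈ prefixes Ω := by
  obtain ⟨x, hx⟩ := hΩ
  exact Set.mem_iUnion.2 ⟨0, rfl, x, hx, fun i hi => absurd hi (Nat.not_lt_zero i)⟩

/-- The tree of prefixes `Γ(Ω)`: its vertices are the prefixes, and there is an edge from `u` to
every prefix of the form `u i` with a single letter `i`. -/
def prefixTree (Ω : Set (SymbolicSpace m)) : Digraph (prefixes Ω) where
  Adj u v := ∃ i : Fin m, (v : List (Fin m)) = (u : List (Fin m)) ++ [i]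

/-- The tree of prefixes is spherically symmetric: for every `k`, all prefixes of length `k` have
the same number of continuations in `Pref_{k+1}(Ω)`. -/
def IsSphericallySymmetric (Ω : Set (SymbolicSpace m)) : Prop :=
  ∀ k : ℕ, ∀ u ∈ prefixesOfLength Ω k, ∀ v ∈ prefixesOfLength Ω k,
    {i : Fin m | u ++ [i] ∈ prefixesOfLength Ω (k + 1)}.ncard =
      {i : Fin m | v ++ [i] ∈ prefixesOfLength Ω (k + 1)}.ncard

end SymbolicSpace

/-- For a directed graph `G` with outdegrees bounded by `M`: the vector `t` lies in
`[1, M^{1/(q-1)}]^V` and satisfies `t_v ^ q = ∑_{vw ∈ E} t_w` for every vertex `v`. -/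
def IsPowerSumVector {V : Type*} (G : Digraph V) (M q : ℕ) (t : V → ℝ) : Prop :=
  (∀ v, t v ∈ Set.Icc (1 : ℝ) ((M : ℝ) ^ (1 / ((q : ℝ) - 1)))) ∧
    ∀ v, t v ^ q = ∑ᶠ (w : V) (_ : G.Adj v w), t w

section Minkowski

variable {X : Type*} [MetricSpace X]

/-- `log N(ε) / log (1/ε)`, where `N(ε)` is the least number of closed balls of radius `ε` centred
in `A` that cover `A`. -/
def boxRatio (A : Set X) (ε : ℝ≥0) : EReal :=
  ENNReal.log (Metric.coveringNumber ε A : ℝ≥0∞) / ((Real.log (1 / (ε : ℝ)) : ℝ) : EReal)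

/-- The lower Minkowski (box-counting) dimension. -/
def lowerMinkowskiDim (A : Set X) : EReal := liminf (boxRatio A) (𝓝[>] 0)

/-- The upper Minkowski (box-counting) dimension. -/
def upperMinkowskiDim (A : Set X) : EReal := limsup (boxRatio A) (𝓝[>] 0)

/-- The Minkowski dimension of `A` exists and equals `d`. -/
def HasMinkowskiDim (A : Set X) (d : EReal) : Prop :=
  lowerMinkowskiDim A = d ∧ upperMinkowskiDim A = d

end Minkowski

end

/-! Every position `j ≥ 1` is uniquely `i * q ^ ℓ` with `q ∤ i`, so a point of `X_Ω` is a free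
choice of one element of `Ω` for each such `i`.

Counting: the number of initial words of length `n` is a product of prefix counts over the `i ≤ n`
(`ncard_restr_image`). Its logarithm is a sum over positions of increments of `log |Pref_k|`. Depth
`ℓ` has frequency `(1 - 1/q) / q ^ ℓ`, and summation by parts gives the Minkowski dimension.

Hausdorff dimension: the equation `t_u ^ q = ∑ t_{uc}` makes `t_{uc} / t_u ^ q` transition
probabilities on the tree. Run independent copies of this Markov chain along all progressions. If
`S(n)` is the sum of `log t` over the prefixes ending at positions `1, …, n`, then the logarithm of
the measure of an `n`-cylinder is `S(n) - q S(⌊n/q⌋) - q (n - ⌊n/q⌋) log t_∅`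
(`gluedMeasure_cylinder_eq_exp`). The last term is asymptotically `-n (q - 1) log t_∅`, the claimed
dimension. The first two are harmless. At every point, since `S ≥ 0`, the averages `S(q ^ k) / q ^
k` cannot drop by a fixed amount at every step, so infinitely many cylinders are heavy enough for
the upper bound. Almost surely, `S(n) / n` converges by the law of large numbers, so the two terms
cancel to order `o(n)`, and the mass distribution principle gives the lower bound.

Equality: the sum of `t` over level `k + 1` is the sum of `t ^ q` over level `k`. Jensen's
inequality on each level gives a nonnegative gap. The weighted gaps telescope to `(q - 1) ∑ log
|Pref_k| / q ^ (k + 1) - log t_∅` (`hasSum_gap`). They all vanish exactly when `t` is constant on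
levels, which means spherical symmetry. -/

/-! ### Geometric progressions with ratio `q` -/

namespace GeomProg

/-- The exponent of the largest power of `q` that divides `j`. -/
noncomputable def depth (q j : ℕ) : ℕ := multiplicity q j

/-- The initial term of the geometric progression with ratio `q` through `j`. -/
noncomputable def root (q j : ℕ) : ℕ := j / q ^ depth q j

variable {q : ℕ}

theorem root_mul_pow_depth (q j : ℕ) : root q j * q ^ depth q j = j :=
  Nat.div_mul_cancel (pow_multiplicity_dvd q j)

theorem not_dvd_root (hq : 2 ≤ q) {j : ℕ} (hj : 1 ≤ j) : ¬ q ∣ root q j := by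
  intro h
  have hf : FiniteMultiplicity q j := Nat.finiteMultiplicity_iff.2 ⟨by omega, by omega⟩
  refine hf.not_pow_dvd_of_multiplicity_lt (Nat.lt_succ_self _) ?_
  have := mul_dvd_mul_right h (q ^ depth q j)
  rw [root_mul_pow_depth] at this
  rw [Nat.succ_eq_add_one, pow_succ']
  exact this

theorem one_le_root {j : ℕ} (hj : 1 ≤ j) : 1 ≤ root q j := by
  by_contra h
  have h0 : root q j = 0 := by omega
  have := root_mul_pow_depth q j
  rw [h0] at this
  omega

theorem depth_mul_pow (hq : 2 ≤ q) {i : ℕ} (hi : ¬ q ∣ i) (ℓ : ℕ) : depth q (i * q ^ ℓ) = ℓ := by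
  refine multiplicity_eq_of_dvd_of_not_dvd (dvd_mul_left _ _) fun h => hi ?_
  rw [pow_succ', Nat.mul_dvd_mul_iff_right (by positivity)] at h
  exact h

theorem root_mul_pow (hq : 2 ≤ q) {i : ℕ} (hi : ¬ q ∣ i) (ℓ : ℕ) : root q (i * q ^ ℓ) = i := by
  rw [root, depth_mul_pow hq hi, Nat.mul_div_cancel _ (by positivity)]

theorem depth_mul (hq : 2 ≤ q) {j : ℕ} (hj : 1 ≤ j) : depth q (q * j) = depth q j + 1 := by
  conv_lhs => rw [← root_mul_pow_depth q j, mul_left_comm, ← pow_succ']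
  exact depth_mul_pow hq (not_dvd_root hq hj) _

theorem root_mul (hq : 2 ≤ q) {j : ℕ} (hj : 1 ≤ j) : root q (q * j) = root q j := by
  conv_lhs => rw [← root_mul_pow_depth q j, mul_left_comm, ← pow_succ']
  exact root_mul_pow hq (not_dvd_root hq hj) _

theorem depth_eq_zero (hq : 2 ≤ q) {i : ℕ} (hi : ¬ q ∣ i) : depth q i = 0 := by
  simpa using depth_mul_pow hq hi 0

theorem root_eq_self (hq : 2 ≤ q) {i : ℕ} (hi : ¬ q ∣ i) : root q i = i := by
  simpa using root_mul_pow hq hi 0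

theorem sum_Icc_eq_add (hq : 2 ≤ q) (f : ℕ → ℝ) (n : ℕ) :
    ∑ j ∈ Finset.Icc 1 n, f j =
      ∑ j ∈ Finset.Icc 1 n with ¬ q ∣ j, f j + ∑ j ∈ Finset.Icc 1 (n / q), f (q * j) := by
  rw [← Finset.sum_filter_add_sum_filter_not (Finset.Icc 1 n) (fun j => ¬ q ∣ j) f]
  congr 1
  symm
  refine Finset.sum_nbij (fun j => q * j) ?_ ?_ ?_ (fun _ _ => rfl)
  · intro j hj
    rw [Finset.mem_Icc] at hj
    have := (Nat.le_div_iff_mul_le (by omega : 0 < q)).1 hj.2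
    simp only [Finset.mem_filter, Finset.mem_Icc, not_not]
    refine ⟨⟨Nat.mul_pos (by omega) (by omega), by rwa [mul_comm]⟩, dvd_mul_right _ _⟩
  · intro a _ b _ hab
    exact Nat.eq_of_mul_eq_mul_left (by omega) hab
  · intro j hj
    simp only [Finset.coe_filter, Finset.mem_Icc, not_not, Set.mem_ofPred_eq] at hj
    obtain ⟨⟨h1, h2⟩, k, rfl⟩ := hj
    refine ⟨k, ?_, rfl⟩
    simp only [Finset.coe_Icc, Set.mem_Icc]
    refine ⟨Nat.pos_of_mul_pos_left h1, ?_⟩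
    rw [Nat.le_div_iff_mul_le (by omega), mul_comm]
    exact h2

theorem card_filter_not_dvd (hq : 2 ≤ q) (n : ℕ) :
    ((Finset.Icc 1 n).filter (fun j => ¬ q ∣ j)).card + n / q = n := by
  have := sum_Icc_eq_add hq (fun _ => (1 : ℝ)) n
  simp only [Finset.sum_const, Nat.card_Icc, nsmul_eq_mul, mul_one, Nat.add_sub_cancel] at this
  exact_mod_cast this.symm

/-- Summation along the geometric progressions. -/
theorem sum_root_depth (hq : 2 ≤ q) (Z : ℕ → ℕ → ℝ) (n : ℕ) :
    ∑ j ∈ Finset.Icc 1 n, Z (root q j) (depth q j) =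
      ∑' ℓ, ∑ i ∈ Finset.Icc 1 (n / q ^ ℓ) with ¬ q ∣ i, Z i ℓ := by
  -- The shift `L` is needed for the induction: the multiples of `q` up to `n` are a copy of `1, …,
  -- n / q` with the same roots and all depths raised by one.
  have key : ∀ K L n : ℕ, ∑ j ∈ Finset.Icc 1 n, Z (root q j) (depth q j + L) =
      ∑ ℓ ∈ Finset.range K, ∑ i ∈ Finset.Icc 1 (n / q ^ ℓ) with ¬ q ∣ i, Z i (ℓ + L) +
        ∑ j ∈ Finset.Icc 1 (n / q ^ K), Z (root q j) (depth q j + (K + L)) := by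
    intro K
    induction K with
    | zero => intro L n; simp
    | succ K ih =>
      intro L n
      rw [ih, Finset.sum_range_succ, add_assoc]
      congr 1
      rw [sum_Icc_eq_add hq _ (n / q ^ K), Nat.div_div_eq_div_mul, ← pow_succ]
      congr 1
      · refine Finset.sum_congr rfl fun i hi => ?_
        rw [Finset.mem_filter] at hi
        rw [depth_eq_zero hq hi.2, root_eq_self hq hi.2, zero_add]
      · refine Finset.sum_congr rfl fun i hi => ?_
        rw [Finset.mem_Icc] at hi
        rw [depth_mul hq hi.1, root_mul hq hi.1]
        congr 1
        ring
  have hz : ∀ ℓ, n ≤ ℓ → n / q ^ ℓ = 0 := fun ℓ h =>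
    Nat.div_eq_of_lt ((Nat.lt_pow_self (by omega)).trans_le (Nat.pow_le_pow_right (by omega) h))
  have := key n 0 n
  rw [hz n le_rfl] at this
  simp only [add_zero] at this
  rw [this, tsum_eq_sum (s := Finset.range n)]
  · simp
  · intro ℓ hℓ
    rw [hz ℓ (by simpa using hℓ)]
    simp

theorem tendsto_natDiv_div (a : ℕ) :
    Tendsto (fun n : ℕ => ((n / a : ℕ) : ℝ) / n) atTop (𝓝 (a : ℝ)⁻¹) := by
  have := (tendsto_nat_floor_mul_div_atTop (R := ℝ) (a := (a : ℝ)⁻¹)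
    (by positivity)).comp tendsto_natCast_atTop_atTop
  refine this.congr fun n => ?_
  simp only [Function.comp]
  rw [← Nat.floor_div_eq_div (K := ℝ), div_eq_inv_mul (n : ℝ)]

/-- If all the averages over the initial terms converge, so does the average over all positions. -/
theorem tendsto_average (hq : 2 ≤ q) (Z : ℕ → ℕ → ℝ) (C : ℝ) (hC : ∀ i ℓ, |Z i ℓ| ≤ C)
    (z : ℕ → ℝ)
    (hz : ∀ ℓ, Tendsto (fun N : ℕ => (∑ i ∈ Finset.Icc 1 N with ¬ q ∣ i, Z i ℓ) / N) atTop
      (𝓝 (z ℓ))) :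
    Tendsto (fun n : ℕ => (∑ j ∈ Finset.Icc 1 n, Z (root q j) (depth q j)) / n) atTop
      (𝓝 (∑' ℓ, z ℓ / (q : ℝ) ^ ℓ)) := by
  have hq0 : (0 : ℝ) < q := by positivity
  have hC0 : 0 ≤ C := (abs_nonneg _).trans (hC 0 0)
  simp_rw [sum_root_depth hq, ← tsum_div_const]
  -- At most `n / q ^ ℓ` initial terms contribute at depth `ℓ`, hence the geometric bound uniform in
  -- `n`.
  refine tendsto_tsum_of_dominated_convergence (bound := fun ℓ => C * ((q : ℝ)⁻¹) ^ ℓ) ?_ ?_ ?_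
  · refine (summable_geometric_of_lt_one (by positivity) ?_).mul_left _
    exact inv_lt_one_of_one_lt₀ (by exact_mod_cast (by omega : 1 < q))
  · intro ℓ
    have h1 : Tendsto (fun n : ℕ => n / q ^ ℓ) atTop atTop :=
      Nat.tendsto_div_const_atTop (by positivity)
    have h2 : Tendsto (fun n : ℕ => ((n / q ^ ℓ : ℕ) : ℝ) / n) atTop (𝓝 (((q : ℝ) ^ ℓ)⁻¹)) := by
      exact_mod_cast tendsto_natDiv_div (q ^ ℓ)
    have := ((hz ℓ).comp h1).mul h2
    rw [← div_eq_mul_inv] at this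
    refine this.congr fun n => ?_
    simp only [Function.comp]
    rcases Nat.eq_zero_or_pos (n / q ^ ℓ) with h | h
    · rw [h]; simp
    · have : ((n / q ^ ℓ : ℕ) : ℝ) ≠ 0 := by positivity
      field_simp
  · refine Eventually.of_forall fun n ℓ => ?_
    rw [Real.norm_eq_abs, abs_div, Nat.abs_cast]
    rcases Nat.eq_zero_or_pos n with h | h
    · subst h
      simp only [Nat.cast_zero, div_zero]
      positivity
    rw [div_le_iff₀ (by positivity)]
    calc |∑ i ∈ Finset.Icc 1 (n / q ^ ℓ) with ¬ q ∣ i, Z i ℓ|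
        ≤ ∑ i ∈ Finset.Icc 1 (n / q ^ ℓ) with ¬ q ∣ i, |Z i ℓ| := Finset.abs_sum_le_sum_abs _ _
      _ ≤ ∑ i ∈ Finset.Icc 1 (n / q ^ ℓ) with ¬ q ∣ i, C := Finset.sum_le_sum fun i _ => hC i ℓ
      _ ≤ ((n / q ^ ℓ : ℕ) : ℝ) * C := by
          rw [Finset.sum_const, nsmul_eq_mul]
          gcongr
          refine (Finset.card_filter_le _ _).trans ?_
          simp
      _ ≤ (n / (q : ℝ) ^ ℓ) * C := by
          gcongr
          exact_mod_cast Nat.cast_div_le (α := ℝ) (m := n) (n := q ^ ℓ)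
      _ = C * (q : ℝ)⁻¹ ^ ℓ * n := by
          rw [inv_pow]; ring

/-- Averages over the integers that `q` does not divide. -/
theorem tendsto_average_not_dvd (hq : 2 ≤ q) (Y : ℕ → ℝ) (y : ℝ)
    (h1 : Tendsto (fun N : ℕ => (∑ i ∈ Finset.Icc 1 N, Y i) / N) atTop (𝓝 y))
    (h2 : Tendsto (fun N : ℕ => (∑ i ∈ Finset.Icc 1 N, Y (q * i)) / N) atTop (𝓝 y)) :
    Tendsto (fun N : ℕ => (∑ i ∈ Finset.Icc 1 N with ¬ q ∣ i, Y i) / N) atTop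
      (𝓝 ((1 - (q : ℝ)⁻¹) * y)) := by
  have h3 : Tendsto (fun n : ℕ => n / q) atTop atTop :=
    Nat.tendsto_div_const_atTop (by positivity)
  have h4 : Tendsto (fun n : ℕ => ((n / q : ℕ) : ℝ) / n) atTop (𝓝 (q : ℝ)⁻¹) :=
    tendsto_natDiv_div q
  -- A sum over non-multiples is the full sum minus the sum over multiples, and the multiples have
  -- density `1 / q`.
  have := h1.sub (h4.mul (h2.comp h3))
  rw [show y - (q : ℝ)⁻¹ * y = (1 - (q : ℝ)⁻¹) * y by ring] at this
  refine this.congr fun n => ?_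
  simp only [Function.comp]
  rw [sum_Icc_eq_add hq Y n]
  rcases Nat.eq_zero_or_pos (n / q) with h | h
  · rw [h]; simp
  · have : ((n / q : ℕ) : ℝ) ≠ 0 := by positivity
    field_simp
    ring

theorem tendsto_average_not_dvd_const (hq : 2 ≤ q) (y : ℝ) :
    Tendsto (fun N : ℕ => (∑ i ∈ Finset.Icc 1 N with ¬ q ∣ i, y) / N) atTop
      (𝓝 ((1 - (q : ℝ)⁻¹) * y)) := by
  have : Tendsto (fun N : ℕ => (∑ i ∈ Finset.Icc 1 N, y) / (N : ℝ)) atTop (𝓝 y) := by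
    refine tendsto_const_nhds.congr' ?_
    filter_upwards [eventually_gt_atTop 0] with N hN
    have : (N : ℝ) ≠ 0 := by positivity
    simp
    field_simp
  exact tendsto_average_not_dvd hq (fun _ => y) y this this

end GeomProg

/-! ### Power-sum functions on prefix trees -/

/-- A set of words that contains the empty word, is closed under prefixes and in which every word
has a continuation. -/
structure IsPrunedTree {α : Type*} (T : Set (List α)) : Prop where
  nil_mem : [] ∈ T
  of_append : ∀ u c, u ++ [c] ∈ T → u ∈ T
  exists_append : ∀ u ∈ T, ∃ c, u ++ [c] ∈ T

/-- The functions on words that correspond to power-sum vectors on the tree `T`. -/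
structure IsPowerSumFun {α : Type*} [Fintype α] (T : Set (List α)) (B : ℝ) (q : ℕ)
    (τ : List α → ℝ) : Prop where
  one_le : ∀ u ∈ T, 1 ≤ τ u
  le_bound : ∀ u ∈ T, τ u ≤ B
  eq_zero : ∀ u ∉ T, τ u = 0
  pow_eq : ∀ u ∈ T, τ u ^ q = ∑ c, τ (u ++ [c])

/-- The crude bound `a ≤ B * b` improves itself: `step` followed by a `q`-th root replaces the
factor `B` by `B ^ (1/q)`, and iteration drives it to `1`. It serves both uniqueness and constancy
on levels. -/
theorem le_of_pow_contraction {I : Type*} (a b : I → ℝ) {B : ℝ} {q : ℕ} (hq : 2 ≤ q) (hB : 1 ≤ B)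
    (haB : ∀ i, a i ≤ B) (hb : ∀ i, 1 ≤ b i)
    (step : ∀ l : ℝ, 0 ≤ l → (∀ i, a i ≤ l * b i) → ∀ i, a i ^ q ≤ l * b i ^ q) (i : I) :
    a i ≤ b i := by
  have key : ∀ k : ℕ, ∀ i, a i ≤ B ^ (((q : ℝ)⁻¹) ^ k) * b i := by
    intro k
    induction k with
    | zero =>
      intro i
      rw [pow_zero, Real.rpow_one]
      nlinarith [haB i, hb i]
    | succ k ih =>
      intro i
      have h := step _ (by positivity) ih i
      refine le_of_pow_le_pow_left₀ (n := q) (by omega) ?_ ?_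
      · have := hb i
        positivity
      · rw [mul_pow, ← Real.rpow_natCast (B ^ _) q, ← Real.rpow_mul (by positivity), pow_succ,
          mul_assoc, inv_mul_cancel₀ (by positivity), mul_one]
        exact h
  have h0 : Tendsto (fun k : ℕ => ((q : ℝ)⁻¹) ^ k) atTop (𝓝 0) :=
    tendsto_pow_atTop_nhds_zero_of_lt_one (by positivity)
      (inv_lt_one_of_one_lt₀ (by exact_mod_cast (by omega : 1 < q)))
  have h1 : Tendsto (fun k : ℕ => B ^ (((q : ℝ)⁻¹) ^ k) * b i) atTop (𝓝 (b i)) := by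
    have := (Real.continuous_const_rpow (a := B) (by positivity)).continuousAt.tendsto.comp h0
    rw [Real.rpow_zero] at this
    simpa using this.mul_const (b i)
  exact ge_of_tendsto' h1 fun k => key k i

namespace IsPrunedTree

variable {α : Type*} [Fintype α] {T : Set (List α)}

open Classical in
/-- Monotone approximations of the power-sum function. -/
noncomputable def approx (T : Set (List α)) (q : ℕ) : ℕ → List α → ℝ
  | 0, u => if u ∈ T then 1 else 0
  | n + 1, u => if u ∈ T then (∑ c, approx T q n (u ++ [c])) ^ ((q : ℝ)⁻¹) else 0

theorem approx_nonneg (q n : ℕ) (u : List α) : 0 ≤ approx T q n u := by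
  induction n generalizing u with
  | zero => unfold approx; split_ifs <;> norm_num
  | succ n ih =>
    unfold approx
    split_ifs
    · exact Real.rpow_nonneg (Finset.sum_nonneg fun c _ => ih _) _
    · exact le_rfl

theorem approx_le_succ (hT : IsPrunedTree T) (q n : ℕ) (u : List α) :
    approx T q n u ≤ approx T q (n + 1) u := by
  induction n generalizing u with
  | zero =>
    rw [approx, approx]
    split_ifs with h
    · obtain ⟨c, hc⟩ := hT.exists_append u h
      refine Real.one_le_rpow ?_ (by positivity)
      calc (1 : ℝ) = approx T q 0 (u ++ [c]) := by rw [approx, if_pos hc]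
        _ ≤ _ := Finset.single_le_sum (f := fun c => approx T q 0 (u ++ [c]))
            (fun c _ => approx_nonneg _ _ _) (Finset.mem_univ c)
    · exact le_rfl
  | succ n ih =>
    rw [approx, approx]
    split_ifs with h
    · exact Real.rpow_le_rpow (Finset.sum_nonneg fun c _ => approx_nonneg _ _ _)
        (Finset.sum_le_sum fun c _ => ih _) (by positivity)
    · exact le_rfl

/-- A word has at most `card α` children, so the bound `B` reproduces itself when `B ^ q = card α *
B`. This is where the constant `m ^ (1/(q-1))` comes from. -/
theorem approx_le {q : ℕ} (hq : 2 ≤ q) {B : ℝ} (hB : 1 ≤ B) (hBq : B ^ q = Fintype.card α * B)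
    (n : ℕ) (u : List α) : approx T q n u ≤ B := by
  induction n generalizing u with
  | zero =>
    rw [approx]
    split_ifs <;> linarith
  | succ n ih =>
    rw [approx]
    split_ifs
    · calc (∑ c, approx T q n (u ++ [c])) ^ ((q : ℝ)⁻¹) ≤ (B ^ q) ^ ((q : ℝ)⁻¹) := by
            refine Real.rpow_le_rpow (Finset.sum_nonneg fun c _ => approx_nonneg _ _ _) ?_
              (by positivity)
            rw [hBq]
            refine (Finset.sum_le_sum fun c _ => ih (u ++ [c])).trans ?_
            simp
        _ = B := Real.pow_rpow_inv_natCast (by linarith) (by omega)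
    · linarith

theorem exists_isPowerSumFun (hT : IsPrunedTree T) {q : ℕ} (hq : 2 ≤ q) {B : ℝ} (hB : 1 ≤ B)
    (hBq : B ^ q = Fintype.card α * B) : ∃ τ, IsPowerSumFun T B q τ := by
  have hmono : ∀ u, Monotone fun n => approx T q n u := fun u =>
    monotone_nat_of_le_succ fun n => hT.approx_le_succ q n u
  have hbdd : ∀ u, BddAbove (Set.range fun n => approx T q n u) := fun u =>
    ⟨B, by rintro _ ⟨n, rfl⟩; exact approx_le hq hB hBq n u⟩
  have hlim : ∀ u, Tendsto (fun n => approx T q n u) atTop (𝓝 (⨆ n, approx T q n u)) := fun u =>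
    tendsto_atTop_ciSup (hmono u) (hbdd u)
  refine ⟨fun u => ⨆ n, approx T q n u, ?_, ?_, ?_, ?_⟩
  · intro u hu
    refine le_ciSup_of_le (hbdd u) 0 ?_
    rw [approx, if_pos hu]
  · exact fun u _ => ciSup_le fun n => approx_le hq hB hBq n u
  · intro u hu
    have : ∀ n, approx T q n u = 0 := by
      intro n
      cases n <;> rw [approx, if_neg hu]
    simp [this]
  · intro u hu
    have h1 := ((hlim u).comp (tendsto_add_atTop_nat 1)).pow q
    have h2 : Tendsto (fun n => ∑ c, approx T q n (u ++ [c])) atTop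
        (𝓝 (∑ c, ⨆ n, approx T q n (u ++ [c]))) := tendsto_finsetSum _ fun c _ => hlim _
    refine tendsto_nhds_unique h1 (h2.congr fun n => ?_)
    simp only [Function.comp]
    rw [approx, if_pos hu, Real.rpow_inv_natCast_pow
      (Finset.sum_nonneg fun c _ => approx_nonneg _ _ _) (by omega)]

end IsPrunedTree

namespace IsPowerSumFun

variable {α : Type*} [Fintype α] {T : Set (List α)} {B : ℝ} {q : ℕ} {τ σ : List α → ℝ}

theorem nonneg (hτ : IsPowerSumFun T B q τ) (u : List α) : 0 ≤ τ u := by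
  by_cases hu : u ∈ T
  · exact zero_le_one.trans (hτ.one_le u hu)
  · exact (hτ.eq_zero u hu).ge

theorem one_le_bound (hτ : IsPowerSumFun T B q τ) (hT : IsPrunedTree T) : 1 ≤ B :=
  (hτ.one_le _ hT.nil_mem).trans (hτ.le_bound _ hT.nil_mem)

/-- The equation is linear in the children: `τ ≤ l * σ` on all children of a vertex gives `τ ^ q ≤ l
* σ ^ q` at the vertex, as `le_of_pow_contraction` requires. -/
theorem le (hT : IsPrunedTree T) (hq : 2 ≤ q) (hτ : IsPowerSumFun T B q τ)
    (hσ : IsPowerSumFun T B q σ) (u : List α) : τ u ≤ σ u := by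
  by_cases hu : u ∈ T
  · refine le_of_pow_contraction (I := T) (fun v => τ v) (fun v => σ v) hq (hτ.one_le_bound hT)
      (fun v => hτ.le_bound v v.2) (fun v => hσ.one_le v v.2) ?_ ⟨u, hu⟩
    rintro l hl h ⟨v, hv⟩
    simp only
    rw [hτ.pow_eq v hv, hσ.pow_eq v hv, Finset.mul_sum]
    refine Finset.sum_le_sum fun c _ => ?_
    by_cases hc : v ++ [c] ∈ T
    · exact h ⟨_, hc⟩
    · rw [hτ.eq_zero _ hc, hσ.eq_zero _ hc, mul_zero]
  · rw [hτ.eq_zero u hu, hσ.eq_zero u hu]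

theorem unique (hT : IsPrunedTree T) (hq : 2 ≤ q) (hτ : IsPowerSumFun T B q τ)
    (hσ : IsPowerSumFun T B q σ) : τ = σ :=
  funext fun u => le_antisymm (hτ.le hT hq hσ u) (hσ.le hT hq hτ u)

open Classical in
theorem sum_eq_sum_filter (hτ : IsPowerSumFun T B q τ) (u : List α) :
    ∑ c, τ (u ++ [c]) = ∑ c with u ++ [c] ∈ T, τ (u ++ [c]) := by
  rw [Finset.sum_filter]
  refine Finset.sum_congr rfl fun c _ => ?_
  split_ifs with h
  · rfl
  · exact hτ.eq_zero _ h

open Classical in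
/-- In a spherically symmetric tree the power-sum function depends on the level only. -/
theorem eq_of_length_eq (hT : IsPrunedTree T) (hq : 2 ≤ q) (hτ : IsPowerSumFun T B q τ)
    (hsym : ∀ u ∈ T, ∀ v ∈ T, u.length = v.length →
      (Finset.univ.filter fun c => u ++ [c] ∈ T).card =
        (Finset.univ.filter fun c => v ++ [c] ∈ T).card)
    {u v : List α} (hu : u ∈ T) (hv : v ∈ T) (huv : u.length = v.length) : τ u = τ v := by
  -- The contraction is applied to `τ` against itself on pairs of words of equal length. Equal
  -- numbers of children allow the children to be paired by a bijection.
  have key : ∀ p : {p : List α × List α // p.1 ∈ T ∧ p.2 ∈ T ∧ p.1.length = p.2.length},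
      τ p.1.1 ≤ τ p.1.2 := by
    refine le_of_pow_contraction _ _ hq (hτ.one_le_bound hT)
      (fun p => hτ.le_bound _ p.2.1) (fun p => hτ.one_le _ p.2.2.1) ?_
    rintro l hl h ⟨⟨u, v⟩, hu, hv, huv⟩
    simp only at hu hv huv ⊢
    rw [hτ.pow_eq u hu, hτ.pow_eq v hv, hτ.sum_eq_sum_filter, hτ.sum_eq_sum_filter,
      Finset.mul_sum]
    let e := Finset.equivOfCardEq (hsym u hu v hv huv)
    rw [← Finset.sum_coe_sort, ← Finset.sum_coe_sort (Finset.univ.filter fun c => v ++ [c] ∈ T),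
      ← e.sum_comp]
    refine Finset.sum_le_sum fun c _ => ?_
    have hc := (Finset.mem_filter.1 c.2).2
    have hc' := (Finset.mem_filter.1 (e c).2).2
    exact h ⟨(u ++ [c.1], v ++ [(e c).1]), hc, hc', by simp [huv]⟩
  exact le_antisymm (key ⟨(u, v), hu, hv, huv⟩) (key ⟨(v, u), hv, hu, huv.symm⟩)

end IsPowerSumFun

/-! ### Level counts -/

namespace IsPrunedTree

variable {α : Type*} [Fintype α] {T : Set (List α)}

/-- The words of length `k` in `T`. -/
noncomputable def level (T : Set (List α)) (k : ℕ) : Finset (List α) :=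
  ((List.finite_length_eq α k).subset (Set.inter_subset_right (s := T))).toFinset

theorem mem_level {k : ℕ} {u : List α} : u ∈ level T k ↔ u ∈ T ∧ u.length = k := by
  simp [level]

theorem level_zero (hT : IsPrunedTree T) : level T 0 = {[]} := by
  ext u
  rw [mem_level, Finset.mem_singleton, List.length_eq_zero_iff]
  exact ⟨fun h => h.2, fun h => ⟨h ▸ hT.nil_mem, h⟩⟩

open Classical in
theorem sum_level_succ (hT : IsPrunedTree T) (k : ℕ) (f : List α → ℝ) :
    ∑ u ∈ level T (k + 1), f u =
      ∑ u ∈ level T k, ∑ c with u ++ [c] ∈ T, f (u ++ [c]) := by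
  rw [Finset.sum_sigma']
  symm
  refine Finset.sum_nbij (fun p => p.1 ++ [p.2]) ?_ ?_ ?_ (fun _ _ => rfl)
  · rintro ⟨u, c⟩ h
    simp only [Finset.mem_sigma, mem_level, Finset.mem_filter] at h ⊢
    exact ⟨h.2.2, by simp [h.1.2]⟩
  · rintro ⟨u, c⟩ _ ⟨v, d⟩ _ h
    simp only [List.append_singleton_inj] at h
    obtain ⟨rfl, rfl⟩ := h
    rfl
  · intro w hw
    rw [Finset.mem_coe, mem_level] at hw
    rcases List.eq_nil_or_concat' w with rfl | ⟨u, c, rfl⟩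
    · simp at hw
    · refine ⟨⟨u, c⟩, ?_, rfl⟩
      simp only [Finset.coe_sigma, Set.mem_sigma_iff, Finset.mem_coe, mem_level, Finset.mem_filter,
        Finset.mem_univ, true_and]
      exact ⟨⟨hT.of_append u c hw.1, by simpa using hw.2⟩, hw.1⟩

theorem card_level_le_succ (hT : IsPrunedTree T) (k : ℕ) :
    (level T k).card ≤ (level T (k + 1)).card := by
  classical
  have := hT.sum_level_succ k (fun _ => 1)
  rw [Finset.sum_const, nsmul_eq_mul, mul_one] at this
  rw [← Nat.cast_le (α := ℝ), this, ← mul_one (((level T k).card : ℕ) : ℝ), ← nsmul_eq_mul,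
    ← Finset.sum_const]
  refine Finset.sum_le_sum fun u hu => ?_
  obtain ⟨c, hc⟩ := hT.exists_append u (mem_level.1 hu).1
  exact Finset.single_le_sum (f := fun _ => (1 : ℝ)) (fun _ _ => zero_le_one)
    (Finset.mem_filter.2 ⟨Finset.mem_univ c, hc⟩)

theorem card_level_succ_le (hT : IsPrunedTree T) (k : ℕ) :
    (level T (k + 1)).card ≤ Fintype.card α * (level T k).card := by
  classical
  have := hT.sum_level_succ k (fun _ => 1)
  rw [Finset.sum_const, nsmul_eq_mul, mul_one] at this
  rw [← Nat.cast_le (α := ℝ), this, mul_comm, Nat.cast_mul, ← nsmul_eq_mul, ← Finset.sum_const]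
  refine Finset.sum_le_sum fun u hu => ?_
  rw [Finset.sum_const, nsmul_eq_mul, mul_one, Nat.cast_le]
  exact Finset.card_le_univ _

theorem card_level_pos (hT : IsPrunedTree T) (k : ℕ) : 0 < (level T k).card := by
  induction k with
  | zero => simp [hT.level_zero]
  | succ k ih => exact ih.trans_le (hT.card_level_le_succ k)

theorem card_level_le (hT : IsPrunedTree T) (k : ℕ) : (level T k).card ≤ Fintype.card α ^ k := by
  induction k with
  | zero => simp [hT.level_zero]
  | succ k ih =>
    refine (hT.card_level_succ_le k).trans ?_
    rw [pow_succ']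
    exact Nat.mul_le_mul_left _ ih

theorem log_card_level_nonneg (k : ℕ) : 0 ≤ Real.log (level T k).card :=
  Real.log_natCast_nonneg _

theorem log_card_level_le (hT : IsPrunedTree T) (k : ℕ) :
    Real.log (level T k).card ≤ k * Real.log (Fintype.card α) := by
  rw [← Real.log_pow]
  refine Real.log_le_log (by exact_mod_cast hT.card_level_pos k) ?_
  exact_mod_cast hT.card_level_le k

theorem summable_log_card_level (hT : IsPrunedTree T) {q : ℕ} (hq : 2 ≤ q) :
    Summable fun k => Real.log (level T k).card / (q : ℝ) ^ (k + 1) := by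
  have hq1 : (1 : ℝ) < q := by exact_mod_cast (by omega : 1 < q)
  have h : Summable fun k : ℕ => Real.log (Fintype.card α) * (q : ℝ)⁻¹ *
      ((k : ℝ) ^ 1 * (q : ℝ)⁻¹ ^ k) := by
    refine Summable.mul_left _ (summable_pow_mul_geometric_of_norm_lt_one 1 ?_)
    rw [norm_inv, Real.norm_natCast]
    exact inv_lt_one_of_one_lt₀ hq1
  refine h.of_nonneg_of_le (fun k => div_nonneg (log_card_level_nonneg k) (by positivity))
    fun k => ?_
  calc Real.log (level T k).card / (q : ℝ) ^ (k + 1)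
      ≤ k * Real.log (Fintype.card α) / (q : ℝ) ^ (k + 1) := by
        gcongr
        exact hT.log_card_level_le k
    _ = _ := by
        rw [inv_pow, pow_succ]
        field_simp

end IsPrunedTree

/-! ### Power mean gaps between level counts and level sums -/

namespace IsPowerSumFun

open IsPrunedTree

variable {α : Type*} [Fintype α] {T : Set (List α)} {B : ℝ} {q : ℕ} {τ : List α → ℝ}

theorem sum_level_succ (hτ : IsPowerSumFun T B q τ) (hT : IsPrunedTree T) (k : ℕ) :
    ∑ u ∈ level T (k + 1), τ u = ∑ u ∈ level T k, τ u ^ q := by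
  classical
  rw [hT.sum_level_succ]
  refine Finset.sum_congr rfl fun u hu => ?_
  rw [hτ.pow_eq u (mem_level.1 hu).1, hτ.sum_eq_sum_filter]

theorem card_le_sum_level (hτ : IsPowerSumFun T B q τ) (k : ℕ) :
    ((level T k).card : ℝ) ≤ ∑ u ∈ level T k, τ u := by
  rw [← mul_one (((level T k).card : ℕ) : ℝ), ← nsmul_eq_mul, ← Finset.sum_const]
  exact Finset.sum_le_sum fun u hu => hτ.one_le u (mem_level.1 hu).1

theorem sum_level_pos (hτ : IsPowerSumFun T B q τ) (hT : IsPrunedTree T) (k : ℕ) :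
    0 < ∑ u ∈ level T k, τ u :=
  lt_of_lt_of_le (by exact_mod_cast hT.card_level_pos k) (hτ.card_le_sum_level k)

theorem sum_level_le (hτ : IsPowerSumFun T B q τ) (k : ℕ) :
    ∑ u ∈ level T k, τ u ≤ (level T k).card * B := by
  rw [← nsmul_eq_mul, ← Finset.sum_const]
  exact Finset.sum_le_sum fun u hu => hτ.le_bound u (mem_level.1 hu).1

/-- The gap in the power mean inequality at level `k`. -/
noncomputable def gap (T : Set (List α)) (q : ℕ) (τ : List α → ℝ) (k : ℕ) : ℝ :=
  (((q : ℝ) - 1) * Real.log (level T k).card + Real.log (∑ u ∈ level T (k + 1), τ u) -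
    q * Real.log (∑ u ∈ level T k, τ u)) / (q : ℝ) ^ (k + 1)

/-- Normalising by the size of the level turns the gap into the difference of logarithms in Jensen's
inequality for `x ↦ x ^ q` with uniform weights. -/
theorem gap_eq (hτ : IsPowerSumFun T B q τ) (hT : IsPrunedTree T) (k : ℕ) :
    gap T q τ k = (Real.log (∑ u ∈ level T k, ((level T k).card : ℝ)⁻¹ • τ u ^ q) -
      Real.log ((∑ u ∈ level T k, ((level T k).card : ℝ)⁻¹ • τ u) ^ q)) / (q : ℝ) ^ (k + 1) := by
  have hN : (0 : ℝ) < (level T k).card := by exact_mod_cast hT.card_level_pos k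
  have h1 := hτ.sum_level_pos hT k
  have h2 := hτ.sum_level_pos hT (k + 1)
  simp only [smul_eq_mul]
  rw [gap, ← Finset.mul_sum, ← Finset.mul_sum, ← hτ.sum_level_succ hT,
    Real.log_mul (by positivity) h2.ne', Real.log_pow, Real.log_mul (by positivity) h1.ne',
    Real.log_inv]
  congr 1
  ring

theorem jensen (hτ : IsPowerSumFun T B q τ) (hT : IsPrunedTree T) (hq : 2 ≤ q) (k : ℕ) :
    (∑ u ∈ level T k, ((level T k).card : ℝ)⁻¹ • τ u) ^ q ≤
      ∑ u ∈ level T k, ((level T k).card : ℝ)⁻¹ • τ u ^ q ∧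
    ((∑ u ∈ level T k, ((level T k).card : ℝ)⁻¹ • τ u) ^ q =
      ∑ u ∈ level T k, ((level T k).card : ℝ)⁻¹ • τ u ^ q ↔
        ∀ u ∈ level T k, τ u = ∑ u ∈ level T k, ((level T k).card : ℝ)⁻¹ • τ u) := by
  have hN : (0 : ℝ) < (level T k).card := by exact_mod_cast hT.card_level_pos k
  have hw : ∑ u ∈ level T k, ((level T k).card : ℝ)⁻¹ = 1 := by
    rw [Finset.sum_const, nsmul_eq_mul, mul_inv_cancel₀ hN.ne']
  exact ⟨(strictConvexOn_pow hq).convexOn.map_sum_le (fun _ _ => by positivity) hw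
      (fun u _ => hτ.nonneg u),
    (strictConvexOn_pow hq).map_sum_eq_iff (fun _ _ => by positivity) hw
      (fun u _ => hτ.nonneg u)⟩

theorem mean_pos (hτ : IsPowerSumFun T B q τ) (hT : IsPrunedTree T) (k : ℕ) :
    0 < ∑ u ∈ level T k, ((level T k).card : ℝ)⁻¹ • τ u := by
  have hN : (0 : ℝ) < (level T k).card := by exact_mod_cast hT.card_level_pos k
  rw [← Finset.smul_sum, smul_eq_mul]
  exact mul_pos (by positivity) (hτ.sum_level_pos hT k)

theorem gap_nonneg (hτ : IsPowerSumFun T B q τ) (hT : IsPrunedTree T) (hq : 2 ≤ q) (k : ℕ) :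
    0 ≤ gap T q τ k := by
  rw [hτ.gap_eq hT]
  refine div_nonneg (sub_nonneg.2 (Real.log_le_log (pow_pos (hτ.mean_pos hT k) q) ?_))
    (by positivity)
  exact (hτ.jensen hT hq k).1

theorem gap_eq_zero_iff (hτ : IsPowerSumFun T B q τ) (hT : IsPrunedTree T) (hq : 2 ≤ q) (k : ℕ) :
    gap T q τ k = 0 ↔ ∀ u ∈ level T k, ∀ v ∈ level T k, τ u = τ v := by
  have hp := pow_pos (hτ.mean_pos hT k) q
  have hN : (0 : ℝ) < (level T k).card := by exact_mod_cast hT.card_level_pos k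
  have hq0 : (q : ℝ) ^ (k + 1) ≠ 0 := by positivity
  rw [hτ.gap_eq hT, div_eq_zero_iff, or_iff_left hq0, sub_eq_zero,
    Real.log_injOn_pos.eq_iff (hp.trans_le (hτ.jensen hT hq k).1) hp, eq_comm,
    (hτ.jensen hT hq k).2]
  constructor
  · intro h u hu v hv
    rw [h u hu, h v hv]
  · intro h u hu
    rw [Finset.sum_congr rfl fun v hv => by rw [h v hv u hu], Finset.sum_const, nsmul_eq_mul,
      smul_eq_mul, mul_inv_cancel_left₀ hN.ne']

/-- The terms `log (∑ τ) / q ^ k` telescope, starting from level `0`, whose only word is `[]`. -/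
theorem sum_range_gap (hT : IsPrunedTree T) (hq : 2 ≤ q) (K : ℕ) :
    ∑ k ∈ Finset.range K, gap T q τ k =
      ((q : ℝ) - 1) * ∑ k ∈ Finset.range K, Real.log (level T k).card / (q : ℝ) ^ (k + 1) +
        Real.log (∑ u ∈ level T K, τ u) / (q : ℝ) ^ K - Real.log (τ []) := by
  induction K with
  | zero => simp [hT.level_zero]
  | succ K ih =>
    have hq0 : (q : ℝ) ≠ 0 := by positivity
    rw [Finset.sum_range_succ, Finset.sum_range_succ, ih, gap]
    field_simp
    ring

theorem hasSum_gap (hτ : IsPowerSumFun T B q τ) (hT : IsPrunedTree T) (hq : 2 ≤ q) :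
    HasSum (gap T q τ) (((q : ℝ) - 1) * ∑' k, Real.log (level T k).card / (q : ℝ) ^ (k + 1) -
      Real.log (τ [])) := by
  rw [hasSum_iff_tendsto_nat_of_nonneg (hτ.gap_nonneg hT hq)]
  simp_rw [sum_range_gap hT hq]
  have hs := hT.summable_log_card_level hq
  have hq0 : (q : ℝ) ≠ 0 := by positivity
  have hq1 : (1 : ℝ) < q := by exact_mod_cast (by omega : 1 < q)
  have h1 := hs.hasSum.tendsto_sum_nat.const_mul ((q : ℝ) - 1)
  -- The boundary term vanishes because `1 ≤ τ ≤ B`: the level sum is the level count up to a factor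
  -- at most `B`, and the logarithm of the count is negligible against `q ^ K`.
  have h2 : Tendsto (fun K => Real.log (∑ u ∈ level T K, τ u) / (q : ℝ) ^ K) atTop (𝓝 0) := by
    have hu : Tendsto (fun K : ℕ => q * (Real.log (level T K).card / (q : ℝ) ^ (K + 1)) +
        Real.log B * (q : ℝ)⁻¹ ^ K) atTop (𝓝 0) := by
      have := (hs.tendsto_atTop_zero.const_mul (q : ℝ)).add
        ((tendsto_pow_atTop_nhds_zero_of_lt_one (r := (q : ℝ)⁻¹) (by positivity)
          (inv_lt_one_of_one_lt₀ hq1)).const_mul (Real.log B))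
      simpa using this
    refine squeeze_zero (fun K => ?_) (fun K => ?_) hu
    · refine div_nonneg (Real.log_nonneg (le_trans ?_ (hτ.card_le_sum_level K))) (by positivity)
      exact_mod_cast hT.card_level_pos K
    · have hN : (0 : ℝ) < (level T K).card := by exact_mod_cast hT.card_level_pos K
      have hB : 0 < B := zero_lt_one.trans_le (hτ.one_le_bound hT)
      have := Real.log_le_log (hτ.sum_level_pos hT K) (hτ.sum_level_le K)
      rw [Real.log_mul hN.ne' hB.ne'] at this
      calc Real.log (∑ u ∈ level T K, τ u) / (q : ℝ) ^ K
          ≤ (Real.log (level T K).card + Real.log B) / (q : ℝ) ^ K := by gcongr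
        _ = _ := by
            rw [pow_succ, inv_pow]
            field_simp
  have := (h1.add h2).sub_const (Real.log (τ []))
  rwa [add_zero] at this

open Classical in
/-- Equality in the comparison of the growth rate of `T` with the power-sum function at the root
holds exactly for spherically symmetric trees. -/
theorem log_eq_iff (hτ : IsPowerSumFun T B q τ) (hT : IsPrunedTree T) (hq : 2 ≤ q) :
    Real.log (τ []) = ((q : ℝ) - 1) * ∑' k, Real.log (level T k).card / (q : ℝ) ^ (k + 1) ↔
      ∀ u ∈ T, ∀ v ∈ T, u.length = v.length →
        (Finset.univ.filter fun c => u ++ [c] ∈ T).card =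
          (Finset.univ.filter fun c => v ++ [c] ∈ T).card := by
  have h := hτ.hasSum_gap hT hq
  have h1 : Real.log (τ []) =
      ((q : ℝ) - 1) * ∑' k, Real.log (level T k).card / (q : ℝ) ^ (k + 1) ↔ gap T q τ = 0 := by
    refine ⟨fun h0 => ?_, fun h0 => ?_⟩
    · rw [h0, sub_self] at h
      exact (hasSum_zero_iff_of_nonneg (hτ.gap_nonneg hT hq)).1 h
    · rw [h0] at h
      linarith [h.unique (hasSum_zero (L := SummationFilter.unconditional ℕ))]
  rw [h1, funext_iff]
  simp only [Pi.zero_apply, hτ.gap_eq_zero_iff hT hq]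
  constructor
  · intro h u hu v hv huv
    have h2 := h u.length u (mem_level.2 ⟨hu, rfl⟩) v (mem_level.2 ⟨hv, huv.symm⟩)
    obtain ⟨c, hc⟩ := hT.exists_append u hu
    -- With `τ` constant on the next level, `τ w ^ q` is the number of children times that constant,
    -- so `τ w` determines the number of children.
    have h3 : ∀ w ∈ T, w.length = u.length → τ w ^ q =
        (Finset.univ.filter fun c => w ++ [c] ∈ T).card * τ (u ++ [c]) := by
      intro w hw hwu
      rw [hτ.pow_eq w hw, hτ.sum_eq_sum_filter, ← nsmul_eq_mul, ← Finset.sum_const]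
      refine Finset.sum_congr rfl fun d hd => ?_
      exact h (u.length + 1) _ (mem_level.2 ⟨(Finset.mem_filter.1 hd).2, by simp [hwu]⟩) _
        (mem_level.2 ⟨hc, by simp⟩)
    have h4 := h3 u hu rfl
    rw [h2, h3 v hv huv.symm] at h4
    have h5 := mul_right_cancel₀ (zero_lt_one.trans_le (hτ.one_le _ hc)).ne' h4
    exact_mod_cast h5.symm
  · intro h k u hu v hv
    rw [mem_level] at hu hv
    exact hτ.eq_of_length_eq hT hq h hu.1 hv.1 (hu.2.trans hv.2.symm)

end IsPowerSumFun

/-! ### The symbolic space -/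

namespace SymbolicSpace

variable {m : ℕ}

/-- The initial word of length `k` of a sequence. -/
def take (x : SymbolicSpace m) (k : ℕ) : List (Fin m) := (List.range k).map fun i => x i

@[simp]
theorem length_take (x : SymbolicSpace m) (k : ℕ) : (take x k).length = k := by simp [take]

@[simp]
theorem take_zero (x : SymbolicSpace m) : take x 0 = [] := rfl

theorem take_succ (x : SymbolicSpace m) (k : ℕ) : take x (k + 1) = take x k ++ [x k] := by
  simp [take, List.range_succ]

theorem take_eq_take_iff {x y : SymbolicSpace m} {k : ℕ} :
    take x k = take y k ↔ ∀ i < k, x i = y i := by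
  simp [take, List.map_inj_left]

theorem mem_cylinder_iff {x : SymbolicSpace m} {u : List (Fin m)} :
    x ∈ cylinder u ↔ take x u.length = u := by
  simp only [cylinder, Set.mem_ofPred_eq]
  constructor
  · intro h
    refine List.ext_getElem (by simp) fun i h1 h2 => ?_
    rw [← h i h2]
    simp [take]
  · intro h i hi
    have : (take x u.length)[i]'(by simpa using hi) = u[i] := by congr 1
    rw [← this]
    simp [take]

theorem mem_prefixes_iff {Ω : Set (SymbolicSpace m)} {u : List (Fin m)} :
    u ∈ prefixes Ω ↔ ∃ x ∈ Ω, take x u.length = u := by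
  simp only [prefixes, prefixesOfLength, Set.mem_iUnion, Set.mem_ofPred_eq, Set.Nonempty,
    Set.mem_inter_iff, mem_cylinder_iff]
  exact ⟨fun ⟨_, _, h⟩ => h, fun h => ⟨_, rfl, h⟩⟩

theorem take_mem_prefixes {Ω : Set (SymbolicSpace m)} {x : SymbolicSpace m} (hx : x ∈ Ω) (k : ℕ) :
    take x k ∈ prefixes Ω :=
  mem_prefixes_iff.2 ⟨x, hx, by rw [length_take]⟩

theorem isPrunedTree_prefixes {Ω : Set (SymbolicSpace m)} (hΩ : Ω.Nonempty) :
    IsPrunedTree (prefixes Ω) where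
  nil_mem := nil_mem_prefixes hΩ
  of_append u c h := by
    obtain ⟨x, hx, h⟩ := mem_prefixes_iff.1 h
    rw [List.length_append, List.length_singleton, take_succ] at h
    exact mem_prefixes_iff.2 ⟨x, hx, (List.append_inj' h rfl).1⟩
  exists_append u hu := by
    obtain ⟨x, hx, h⟩ := mem_prefixes_iff.1 hu
    refine ⟨x u.length, ?_⟩
    nth_rewrite 1 [← h]
    rw [← take_succ]
    exact take_mem_prefixes hx _

theorem mem_prefixesOfLength_iff {Ω : Set (SymbolicSpace m)} {k : ℕ} {u : List (Fin m)} :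
    u ∈ prefixesOfLength Ω k ↔ u ∈ prefixes Ω ∧ u.length = k := by
  rw [mem_prefixes_iff]
  simp only [prefixesOfLength, Set.mem_ofPred_eq, Set.Nonempty, Set.mem_inter_iff,
    mem_cylinder_iff]
  exact and_comm

theorem ncard_prefixesOfLength (Ω : Set (SymbolicSpace m)) (k : ℕ) :
    (prefixesOfLength Ω k).ncard = (IsPrunedTree.level (prefixes Ω) k).card := by
  rw [← Set.ncard_coe_finset]
  congr 1
  ext u
  rw [mem_prefixesOfLength_iff, Finset.mem_coe, IsPrunedTree.mem_level]

theorem dist_le_pow_iff (hm : 2 ≤ m) {x y : SymbolicSpace m} {n : ℕ} :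
    dist x y ≤ ((m : ℝ)⁻¹) ^ n ↔ ∀ k < n, x k = y k := by
  have h1 : (m : ℝ)⁻¹ < 1 := inv_lt_one_of_one_lt₀ (by exact_mod_cast (by omega : 1 < m))
  have h0 : 0 < (m : ℝ)⁻¹ := by positivity
  change rho x y ≤ _ ↔ _
  unfold rho
  by_cases h : x = y
  · subst h
    simp only [if_true, implies_true, iff_true]
    positivity
  · rw [if_neg h, pow_le_pow_iff_right_of_lt_one₀ h0 h1]
    constructor
    · intro h k hk
      exact PiNat.apply_eq_of_lt_firstDiff (E := fun _ => Fin m) (hk.trans_le h)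
    · intro hk
      by_contra! hlt
      exact PiNat.apply_firstDiff_ne (E := fun _ => Fin m) h (hk _ hlt)

theorem exists_dist_eq_pow {x y : SymbolicSpace m} (h : x ≠ y) :
    ∃ n : ℕ, dist x y = ((m : ℝ)⁻¹) ^ n := by
  refine ⟨PiNat.firstDiff (E := fun _ => Fin m) x y, ?_⟩
  change rho x y = _
  rw [rho, if_neg h]

/-- For `m ^ (-n-1) ≤ r < m ^ (-n)`, closed balls of radius `r` are cylinders of length `n + 1`. -/
theorem dist_le_iff (hm : 2 ≤ m) {r : ℝ} {n : ℕ} (h1 : ((m : ℝ)⁻¹) ^ (n + 1) ≤ r)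
    (h2 : r < ((m : ℝ)⁻¹) ^ n) {x y : SymbolicSpace m} :
    dist x y ≤ r ↔ ∀ k < n + 1, x k = y k := by
  have hl : (m : ℝ)⁻¹ < 1 := inv_lt_one_of_one_lt₀ (by exact_mod_cast (by omega : 1 < m))
  have h0 : 0 < (m : ℝ)⁻¹ := by positivity
  rw [← dist_le_pow_iff hm]
  refine ⟨fun h => ?_, fun h => h.trans h1⟩
  by_cases hxy : x = y
  · subst hxy
    rw [dist_self]
    positivity
  obtain ⟨k, hk⟩ := exists_dist_eq_pow hxy
  rw [hk] at h ⊢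
  have := (pow_lt_pow_iff_right_of_lt_one₀ h0 hl).1 (h.trans_lt h2)
  exact pow_le_pow_of_le_one h0.le hl.le this

/-- Each prefix is shared with some point of `Ω`, so `x` is a limit of points of `Ω`. This is how
closedness enters the proof. -/
theorem mem_of_take_mem_prefixes (hm : 2 ≤ m) {Ω : Set (SymbolicSpace m)} (hΩ : IsClosed Ω)
    {x : SymbolicSpace m} (h : ∀ k, take x k ∈ prefixes Ω) : x ∈ Ω := by
  have hl : (m : ℝ)⁻¹ < 1 := inv_lt_one_of_one_lt₀ (by exact_mod_cast (by omega : 1 < m))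
  rw [← hΩ.closure_eq, Metric.mem_closure_iff]
  intro ε hε
  obtain ⟨n, hn⟩ := exists_pow_lt_of_lt_one hε hl
  obtain ⟨y, hy, hxy⟩ := mem_prefixes_iff.1 (h n)
  rw [length_take] at hxy
  exact ⟨y, hy, ((dist_le_pow_iff hm).2 (take_eq_take_iff.1 hxy.symm)).trans_lt hn⟩

/-- The first `n` letters of a sequence. -/
def restr (n : ℕ) (x : SymbolicSpace m) : Fin n → Fin m := fun k => x k

theorem restr_eq_restr_iff {n : ℕ} {x y : SymbolicSpace m} :
    restr n x = restr n y ↔ ∀ k < n, x k = y k := by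
  rw [funext_iff, Fin.forall_iff]
  rfl

/-! ### Splitting a sequence along geometric progressions -/

/-- The subsequence along the geometric progression with initial term `i` and ratio `q`. -/
def progSeq (q i : ℕ) (x : SymbolicSpace m) : SymbolicSpace m := fun ℓ => x (i * q ^ ℓ - 1)

/-- The sequence with given subsequences along the geometric progressions with ratio `q`. -/
noncomputable def glue (q : ℕ) (ω : ℕ → SymbolicSpace m) : SymbolicSpace m :=
  fun k => ω (GeomProg.root q (k + 1)) (GeomProg.depth q (k + 1))

theorem progSeq_apply_depth (q : ℕ) {k : ℕ} (x : SymbolicSpace m) :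
    progSeq q (GeomProg.root q (k + 1)) x (GeomProg.depth q (k + 1)) = x k := by
  rw [progSeq, GeomProg.root_mul_pow_depth, Nat.add_sub_cancel]

theorem pow_pos_of_not_dvd {q i : ℕ} (hq : 2 ≤ q) (hi : ¬ q ∣ i) (ℓ : ℕ) : 1 ≤ i * q ^ ℓ :=
  Nat.mul_pos (Nat.pos_of_ne_zero fun h => hi (h ▸ dvd_zero q)) (by positivity)

theorem progSeq_glue {q i : ℕ} (hq : 2 ≤ q) (hi : ¬ q ∣ i) (ω : ℕ → SymbolicSpace m) :
    progSeq q i (glue q ω) = ω i := by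
  funext ℓ
  rw [progSeq, glue, Nat.sub_add_cancel (pow_pos_of_not_dvd hq hi ℓ), GeomProg.root_mul_pow hq hi,
    GeomProg.depth_mul_pow hq hi]

theorem mem_multiplicativeSubshift_iff {q : ℕ} {Ω : Set (SymbolicSpace m)} {x : SymbolicSpace m} :
    x ∈ multiplicativeSubshift q Ω ↔ ∀ i, ¬ q ∣ i → progSeq q i x ∈ Ω := by
  refine ⟨fun h i hi => h i ?_ hi, fun h i _ hi => h i hi⟩
  exact Nat.pos_of_ne_zero fun h => hi (h ▸ dvd_zero q)

theorem glue_mem_multiplicativeSubshift {q : ℕ} (hq : 2 ≤ q) {Ω : Set (SymbolicSpace m)}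
    {ω : ℕ → SymbolicSpace m} (hω : ∀ i, ¬ q ∣ i → ω i ∈ Ω) :
    glue q ω ∈ multiplicativeSubshift q Ω :=
  mem_multiplicativeSubshift_iff.2 fun i hi => by
    rw [progSeq_glue hq hi]
    exact hω i hi

/-- The number of terms `≤ n` of the geometric progression with initial term `i` and ratio `q`. -/
def progLength (q n i : ℕ) : ℕ := Nat.log q (n / i) + 1

/-- The hypothesis `i ≤ n` matters: for `i > n` the formula for `progLength` returns `1`, although
no term is at most `n`. -/
theorem lt_progLength_iff {q n i : ℕ} (hq : 2 ≤ q) (h1 : 1 ≤ i) (h2 : i ≤ n) {ℓ : ℕ} :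
    ℓ < progLength q n i ↔ i * q ^ ℓ ≤ n := by
  rw [progLength, Nat.lt_succ_iff, Nat.le_log_iff_pow_le (by omega)
    (Nat.div_pos h2 h1).ne', Nat.le_div_iff_mul_le h1, mul_comm]

theorem root_mem {q n k : ℕ} (hq : 2 ≤ q) (hk : k < n) :
    GeomProg.root q (k + 1) ∈ (Finset.Icc 1 n).filter (fun i => ¬ q ∣ i) := by
  rw [Finset.mem_filter, Finset.mem_Icc]
  refine ⟨⟨GeomProg.one_le_root (by omega), ?_⟩, GeomProg.not_dvd_root hq (by omega)⟩
  exact (Nat.div_le_self _ _).trans hk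

theorem restr_eq_restr_iff_progSeq {q n : ℕ} (hq : 2 ≤ q) {x y : SymbolicSpace m} :
    restr n x = restr n y ↔ ∀ i ∈ (Finset.Icc 1 n).filter (fun i => ¬ q ∣ i),
      take (progSeq q i x) (progLength q n i) = take (progSeq q i y) (progLength q n i) := by
  simp only [restr_eq_restr_iff, take_eq_take_iff]
  constructor
  · intro h i hi ℓ hℓ
    have hi' := Finset.mem_filter.1 hi
    rw [Finset.mem_Icc] at hi'
    rw [lt_progLength_iff hq hi'.1.1 hi'.1.2] at hℓ
    have := pow_pos_of_not_dvd hq hi'.2 ℓ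
    exact h _ (by omega)
  · intro h k hk
    have hr := root_mem hq hk
    have hr' := Finset.mem_filter.1 hr
    rw [Finset.mem_Icc] at hr'
    have := h _ hr (GeomProg.depth q (k + 1))
      ((lt_progLength_iff hq hr'.1.1 hr'.1.2).2 (by rw [GeomProg.root_mul_pow_depth]; exact hk))
    rwa [progSeq_apply_depth, progSeq_apply_depth] at this

theorem ncard_image_eq_of_forall_iff {X A B : Type*} {s : Set X} (f : X → A) (g : X → B)
    (h : ∀ x y, f x = f y ↔ g x = g y) : (f '' s).ncard = (g '' s).ncard := by
  refine Set.ncard_congr (fun a ha => g ha.choose) ?_ ?_ ?_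
  · intro a ha
    exact ⟨_, ha.choose_spec.1, rfl⟩
  · intro a b ha hb hab
    have := (h _ _).2 hab
    rwa [ha.choose_spec.2, hb.choose_spec.2] at this
  · rintro _ ⟨x, hx, rfl⟩
    have ha : f x ∈ f '' s := ⟨x, hx, rfl⟩
    exact ⟨f x, ha, (h _ _).1 ha.choose_spec.2⟩

/-- The first `n` letters amount to one prefix for each progression, and `glue` realises every
family of prefixes. Progressions starting beyond `n` may carry any point of `Ω`. -/
theorem ncard_restr_image {q n : ℕ} (hq : 2 ≤ q) {Ω : Set (SymbolicSpace m)} (hΩ : Ω.Nonempty) :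
    (restr n '' multiplicativeSubshift q Ω).ncard =
      ∏ i ∈ Finset.Icc 1 n with ¬ q ∣ i,
        (IsPrunedTree.level (prefixes Ω) (progLength q n i)).card := by
  rw [ncard_image_eq_of_forall_iff (restr n) (fun x (i : ℕ)
    (_ : i ∈ (Finset.Icc 1 n).filter (fun i => ¬ q ∣ i)) =>
      take (progSeq q i x) (progLength q n i))
    (fun x y => by rw [restr_eq_restr_iff_progSeq hq]; simp only [funext_iff]),
    ← Finset.card_pi, ← Set.ncard_coe_finset]
  congr 1
  ext w
  simp only [Set.mem_image, Finset.mem_coe, Finset.mem_pi, IsPrunedTree.mem_level]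
  constructor
  · rintro ⟨x, hx, rfl⟩ i hi
    rw [mem_multiplicativeSubshift_iff] at hx
    exact ⟨take_mem_prefixes (hx i (Finset.mem_filter.1 hi).2) _, length_take _ _⟩
  · intro hw
    have : ∀ i, ∃ x ∈ Ω, ∀ hi, take x (progLength q n i) = w i hi := by
      intro i
      by_cases hi : i ∈ (Finset.Icc 1 n).filter (fun i => ¬ q ∣ i)
      · obtain ⟨x, hx, hxw⟩ := mem_prefixes_iff.1 (hw i hi).1
        rw [(hw i hi).2] at hxw
        exact ⟨x, hx, fun _ => hxw⟩
      · obtain ⟨x, hx⟩ := hΩ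
        exact ⟨x, hx, fun h => absurd h hi⟩
    choose ω hω hωw using this
    refine ⟨glue q ω, glue_mem_multiplicativeSubshift hq fun i _ => hω i, ?_⟩
    funext i hi
    rw [progSeq_glue hq (Finset.mem_filter.1 hi).2, hωw]

/-! ### The number of words of length `n` -/

theorem sum_root_depth_eq {q : ℕ} (hq : 2 ≤ q) (c : ℕ → ℕ → ℝ) (n : ℕ) :
    ∑ i ∈ Finset.Icc 1 n with ¬ q ∣ i, ∑ ℓ ∈ Finset.range (progLength q n i), c i ℓ =
      ∑ j ∈ Finset.Icc 1 n, c (GeomProg.root q j) (GeomProg.depth q j) := by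
  rw [Finset.sum_sigma']
  refine Finset.sum_nbij' (fun p => p.1 * q ^ p.2)
    (fun j => ⟨GeomProg.root q j, GeomProg.depth q j⟩) ?_ ?_ ?_ ?_ ?_
  · rintro ⟨i, ℓ⟩ h
    simp only [Finset.mem_sigma, Finset.mem_filter, Finset.mem_Icc, Finset.mem_range] at h ⊢
    exact ⟨pow_pos_of_not_dvd hq h.1.2 ℓ, (lt_progLength_iff hq h.1.1.1 h.1.1.2).1 h.2⟩
  · intro j hj
    rw [Finset.mem_Icc] at hj
    obtain ⟨k, rfl⟩ := Nat.exists_eq_add_of_le' hj.1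
    have hr := root_mem hq (Nat.lt_of_succ_le hj.2)
    have hr' := Finset.mem_filter.1 hr
    rw [Finset.mem_Icc] at hr'
    rw [Finset.mem_sigma, Finset.mem_range, lt_progLength_iff hq hr'.1.1 hr'.1.2,
      GeomProg.root_mul_pow_depth]
    exact ⟨hr, hj.2⟩
  · rintro ⟨i, ℓ⟩ h
    simp only [Finset.mem_sigma, Finset.mem_filter] at h
    simp only [GeomProg.root_mul_pow hq h.1.2, GeomProg.depth_mul_pow hq h.1.2]
  · intro j _
    exact GeomProg.root_mul_pow_depth q j
  · rintro ⟨i, ℓ⟩ h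
    simp only [Finset.mem_sigma, Finset.mem_filter] at h
    simp only [GeomProg.root_mul_pow hq h.1.2, GeomProg.depth_mul_pow hq h.1.2]

/-- Writing each factor's logarithm as a telescoping sum from level `0`, where it is zero, charges
one increment to every position. -/
theorem log_ncard_restr_image {q n : ℕ} (hq : 2 ≤ q) {Ω : Set (SymbolicSpace m)}
    (hΩ : Ω.Nonempty) :
    Real.log (restr n '' multiplicativeSubshift q Ω).ncard =
      ∑ j ∈ Finset.Icc 1 n,
        (Real.log (IsPrunedTree.level (prefixes Ω) (GeomProg.depth q j + 1)).card -
          Real.log (IsPrunedTree.level (prefixes Ω) (GeomProg.depth q j)).card) := by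
  have hT := isPrunedTree_prefixes hΩ
  rw [← sum_root_depth_eq hq (fun _ ℓ => Real.log (IsPrunedTree.level (prefixes Ω) (ℓ + 1)).card -
      Real.log (IsPrunedTree.level (prefixes Ω) ℓ).card), ncard_restr_image hq hΩ, Nat.cast_prod,
      Real.log_prod fun i _ => by exact_mod_cast (hT.card_level_pos _).ne']
  refine Finset.sum_congr rfl fun i _ => ?_
  rw [Finset.sum_range_sub (fun ℓ => Real.log (IsPrunedTree.level (prefixes Ω) ℓ).card),
    hT.level_zero]
  simp

theorem tendsto_log_ncard_restr_image {q : ℕ} (hq : 2 ≤ q) {Ω : Set (SymbolicSpace m)}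
    (hΩ : Ω.Nonempty) :
    Tendsto (fun n : ℕ => Real.log (restr n '' multiplicativeSubshift q Ω).ncard / n) atTop
      (𝓝 (((q : ℝ) - 1) ^ 2 *
        ∑' k, Real.log (IsPrunedTree.level (prefixes Ω) k).card / (q : ℝ) ^ (k + 1))) := by
  have hT := isPrunedTree_prefixes hΩ
  have hq0 : (q : ℝ) ≠ 0 := by positivity
  set a : ℕ → ℝ := fun k => Real.log (IsPrunedTree.level (prefixes Ω) k).card with ha
  have ha0 : a 0 = 0 := by simp [ha, hT.level_zero]
  have hs : Summable fun k => a k / (q : ℝ) ^ (k + 1) := hT.summable_log_card_level hq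
  have hs' : Summable fun k => a (k + 1) / (q : ℝ) ^ (k + 2) := (summable_nat_add_iff 1).2 hs
  have hbound : ∀ ℓ, |a (ℓ + 1) - a ℓ| ≤ Real.log m := by
    intro ℓ
    have h1 : a ℓ ≤ a (ℓ + 1) := Real.log_le_log (by exact_mod_cast hT.card_level_pos ℓ)
      (by exact_mod_cast hT.card_level_le_succ ℓ)
    rw [abs_of_nonneg (sub_nonneg.2 h1), sub_le_iff_le_add]
    have h2 := hT.card_level_succ_le ℓ
    rw [Fintype.card_fin] at h2
    have hm0 : m ≠ 0 := by
      rintro rfl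
      have := hT.card_level_pos (ℓ + 1)
      omega
    rw [ha]
    simp only
    rw [← Real.log_mul (by exact_mod_cast hm0) (by exact_mod_cast (hT.card_level_pos ℓ).ne')]
    exact Real.log_le_log (by exact_mod_cast hT.card_level_pos (ℓ + 1)) (by exact_mod_cast h2)
  have := GeomProg.tendsto_average hq (fun _ ℓ => a (ℓ + 1) - a ℓ) (Real.log m)
    (fun _ ℓ => hbound ℓ) _ (fun ℓ => GeomProg.tendsto_average_not_dvd_const hq _)
  simp only [log_ncard_restr_image hq hΩ]
  convert this using 2
  -- Summation by parts: with `a 0 = 0`, both pieces are multiples of `∑ a k / q ^ (k + 1)`, with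
  -- total coefficient `q (q - 1) - (q - 1) = (q - 1) ^ 2`.
  have hrw : ∀ ℓ : ℕ, (1 - (q : ℝ)⁻¹) * (a (ℓ + 1) - a ℓ) / (q : ℝ) ^ ℓ =
      (q : ℝ) * (q - 1) * (a (ℓ + 1) / (q : ℝ) ^ (ℓ + 2)) -
        (q - 1) * (a ℓ / (q : ℝ) ^ (ℓ + 1)) := by
    intro ℓ
    field_simp
    ring
  simp_rw [hrw]
  rw [(hs'.mul_left _).tsum_sub (hs.mul_left _), tsum_mul_left, tsum_mul_left,
    hs.tsum_eq_zero_add, ha0, zero_div, zero_add]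
  ring

end SymbolicSpace

/-! ### Covering numbers and box-counting dimension -/

/-- Balls of radius `ε` are the fibres of `f`, hence pairwise equal or disjoint, and a cover needs
one centre in each fibre that meets `A`. -/
theorem coveringNumber_eq_encard_image {X Y : Type*} [MetricSpace X] {ε : ℝ≥0} {f : X → Y}
    (h : ∀ x y, dist x y ≤ ε ↔ f x = f y) (A : Set X) :
    Metric.coveringNumber ε A = (f '' A).encard := by
  have h' : ∀ x y, edist x y ≤ ε ↔ f x = f y := fun x y => by
    rw [← h, edist_nndist, ENNReal.coe_le_coe, ← NNReal.coe_le_coe, coe_nndist]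
  apply le_antisymm
  · obtain ⟨C, hCA, hC⟩ := (Set.surjOn_image f A).exists_bijOn_subset
    have : Metric.IsCover ε A C := by
      intro x hx
      obtain ⟨y, hy, hxy⟩ := hC.surjOn ⟨x, hx, rfl⟩
      exact ⟨y, hy, (h' _ _).2 hxy.symm⟩
    refine (this.coveringNumber_le_encard hCA).trans ?_
    rw [← hC.image_eq, hC.injOn.encard_image]
  · refine le_iInf₂ fun C hCA => le_iInf fun hC => ?_
    refine le_trans (Set.encard_le_encard ?_) (Set.encard_image_le f C)
    rintro _ ⟨x, hx, rfl⟩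
    obtain ⟨y, hy, hxy⟩ := hC hx
    exact ⟨y, hy, ((h' _ _).1 hxy).symm⟩

namespace SymbolicSpace

variable {m : ℕ}

theorem boxRatio_eq (hm : 2 ≤ m) {A : Set (SymbolicSpace m)} (hA : A.Nonempty) {ε : ℝ≥0}
    (hε : 0 < ε) (hε1 : ε < 1) :
    boxRatio A ε = ((Real.log (restr ⌈Real.log (1 / ε) / Real.log m⌉₊ '' A).ncard /
      Real.log (1 / ε) : ℝ) : EReal) := by
  have hm1 : (1 : ℝ) < m := by exact_mod_cast (by omega : 1 < m)
  have hlm := Real.log_pos hm1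
  have hε' : (0 : ℝ) < ε := by exact_mod_cast hε
  have hle : 0 < Real.log (1 / ε) := Real.log_pos (by
    rw [one_div]
    exact (one_lt_inv₀ hε').2 (by exact_mod_cast hε1))
  set y := Real.log (1 / ε) / Real.log m with hy
  have hy0 : 0 < y := by positivity
  -- `n + 1` is the least length with `m ^ (-(n + 1)) ≤ ε`, so balls of radius `ε` are cylinders of
  -- exactly this length.
  obtain ⟨n, hn⟩ : ∃ n, ⌈y⌉₊ = n + 1 := ⟨⌈y⌉₊ - 1, by have := Nat.ceil_pos.2 hy0; omega⟩
  have hlog : Real.log ε = -(y * Real.log m) := by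
    rw [hy, div_mul_cancel₀ _ hlm.ne', one_div, Real.log_inv, neg_neg]
  have h1 : ((m : ℝ)⁻¹) ^ (n + 1) ≤ ε := by
    rw [← Real.log_le_log_iff (by positivity) hε', hlog, Real.log_pow, Real.log_inv, mul_neg,
      neg_le_neg_iff, ← hn]
    gcongr
    exact Nat.le_ceil y
  have h2 : (ε : ℝ) < ((m : ℝ)⁻¹) ^ n := by
    rw [← Real.log_lt_log_iff hε' (by positivity), hlog, Real.log_pow, Real.log_inv, mul_neg,
      neg_lt_neg_iff]
    gcongr
    exact Nat.lt_ceil.1 (by omega)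
  have hfin : (restr (n + 1) '' A).Finite := Set.toFinite _
  rw [boxRatio, coveringNumber_eq_encard_image (f := restr (n + 1))
    (fun x y => by rw [dist_le_iff hm h1 h2, restr_eq_restr_iff]), hn, ← hfin.cast_ncard_eq,
    EReal.coe_div]
  congr 1
  have hc : ((((restr (n + 1) '' A).ncard : ℕ∞)) : ℝ≥0∞) =
      ENNReal.ofReal ((restr (n + 1) '' A).ncard : ℝ) := by
    rw [ENNReal.ofReal_natCast]
    rfl
  rw [hc, ENNReal.log_ofReal_of_pos]
  exact_mod_cast (Set.ncard_pos hfin).2 (hA.image _)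

theorem hasMinkowskiDim_of_tendsto (hm : 2 ≤ m) {A : Set (SymbolicSpace m)} (hA : A.Nonempty)
    {D : ℝ} (h : Tendsto (fun n : ℕ => Real.log (restr n '' A).ncard / n) atTop (𝓝 D)) :
    HasMinkowskiDim A ((D / Real.log m : ℝ) : EReal) := by
  have hm1 : (1 : ℝ) < m := by exact_mod_cast (by omega : 1 < m)
  have hlm := Real.log_pos hm1
  suffices hlim : Tendsto (boxRatio A) (𝓝[>] 0) (𝓝 ((D / Real.log m : ℝ) : EReal)) from
    ⟨hlim.liminf_eq, hlim.limsup_eq⟩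
  have hy : Tendsto (fun ε : ℝ≥0 => Real.log (1 / ε) / Real.log m) (𝓝[>] 0) atTop := by
    refine Tendsto.atTop_div_const hlm (Real.tendsto_log_atTop.comp ?_)
    simp only [one_div]
    refine tendsto_inv_nhdsGT_zero.comp ?_
    refine tendsto_nhdsWithin_of_tendsto_nhds_of_eventually_within _ ?_ ?_
    · have := (NNReal.continuous_coe.tendsto 0).mono_left
        (nhdsWithin_le_nhds (s := Set.Ioi (0 : ℝ≥0)))
      simpa using this
    · filter_upwards [self_mem_nhdsWithin] with ε hε
      exact NNReal.coe_pos.2 hε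
  have hG : Tendsto (fun y : ℝ => Real.log (restr ⌈y⌉₊ '' A).ncard / (y * Real.log m)) atTop
      (𝓝 (D / Real.log m)) := by
    have h1 := ((h.comp tendsto_nat_ceil_atTop).mul
      (tendsto_nat_ceil_div_atTop (R := ℝ))).div_const (Real.log m)
    rw [mul_one] at h1
    refine h1.congr' ?_
    filter_upwards [eventually_gt_atTop 0] with y hy
    have : (0 : ℝ) < ⌈y⌉₊ := by exact_mod_cast Nat.ceil_pos.2 hy
    simp only [Function.comp]
    field_simp
  refine ((continuous_coe_real_ereal.tendsto _).comp (hG.comp hy)).congr' ?_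
  filter_upwards [self_mem_nhdsWithin, nhdsWithin_le_nhds (Iio_mem_nhds zero_lt_one)] with ε h0 h1
  rw [boxRatio_eq hm hA h0 h1]
  simp only [Function.comp]
  rw [div_mul_cancel₀ _ hlm.ne']

end SymbolicSpace

/-! ### Hausdorff dimension through the local dimension of measures -/

namespace SymbolicSpace

open MeasureTheory

variable {m : ℕ}

noncomputable instance : MeasurableSpace (SymbolicSpace m) := borel _

instance : BorelSpace (SymbolicSpace m) := ⟨rfl⟩

theorem isOpen_of_restr (hm : 2 ≤ m) {S : Set (SymbolicSpace m)} (n : ℕ)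
    (h : ∀ x y, restr n x = restr n y → x ∈ S → y ∈ S) : IsOpen S := by
  rw [Metric.isOpen_iff]
  intro x hx
  refine ⟨((m : ℝ)⁻¹) ^ n, by positivity, fun y hy => h x y ?_ hx⟩
  rw [restr_eq_restr_iff, ← dist_le_pow_iff hm, dist_comm]
  exact (Metric.mem_ball.1 hy).le

theorem measurableSet_restr_preimage (hm : 2 ≤ m) (n : ℕ) (s : Set (Fin n → Fin m)) :
    MeasurableSet (restr n ⁻¹' s) :=
  (isOpen_of_restr hm n fun x y h hx => by rwa [Set.mem_preimage, ← h]).measurableSet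

theorem ediam_restr_preimage_le (hm : 2 ≤ m) (n : ℕ) (w : Fin n → Fin m) :
    Metric.ediam (restr n ⁻¹' {w}) ≤ ENNReal.ofReal (((m : ℝ)⁻¹) ^ n) := by
  refine Metric.ediam_le fun x hx y hy => ?_
  rw [edist_dist]
  refine ENNReal.ofReal_le_ofReal ((dist_le_pow_iff hm).2 (restr_eq_restr_iff.1 ?_))
  rw [Set.mem_preimage, Set.mem_singleton_iff] at hx hy
  rw [hx, hy]

/-- The mass distribution principle. -/
theorem le_dimH_of_measure_le (hm : 2 ≤ m) {P : Measure (SymbolicSpace m)}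
    {A : Set (SymbolicSpace m)} (hA : MeasurableSet A) (hPA : P A ≠ 0) {d : ℝ≥0} (hd : 0 < d)
    (N : ℕ) (h : ∀ x ∈ A, ∀ n, N ≤ n →
      P (restr n ⁻¹' {restr n x}) ≤ ENNReal.ofReal (((m : ℝ)⁻¹) ^ n) ^ (d : ℝ)) :
    d ≤ dimH A := by
  have hl : (m : ℝ)⁻¹ < 1 := inv_lt_one_of_one_lt₀ (by exact_mod_cast (by omega : 1 < m))
  have h0 : 0 < (m : ℝ)⁻¹ := by positivity
  have hd' : (0 : ℝ) < d := hd
  have key : P.restrict A ≤ Measure.hausdorffMeasure d := by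
    refine Measure.le_hausdorffMeasure d _ (ENNReal.ofReal (((m : ℝ)⁻¹) ^ N))
      (ENNReal.ofReal_pos.2 (by positivity)) fun s hs => ?_
    rw [Measure.restrict_apply' hA]
    rcases (s ∩ A).eq_empty_or_nonempty with he | ⟨x, hxs, hxA⟩
    · rw [he, measure_empty]
      exact zero_le
    have hagree : ∀ n : ℕ, (∀ y ∈ s, dist x y ≤ ((m : ℝ)⁻¹) ^ n) → N ≤ n →
        P (s ∩ A) ≤ ENNReal.ofReal (((m : ℝ)⁻¹) ^ n) ^ (d : ℝ) := by
      intro n hn hN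
      refine (measure_mono fun y hy => ?_).trans (h x hxA n hN)
      exact restr_eq_restr_iff.2 ((dist_le_pow_iff hm).1 (by rw [dist_comm]; exact hn y hy.1))
    -- A set of diameter zero lies in cylinders of every length around `x`, whose measures tend to
    -- zero since `d > 0`.
    rcases eq_or_ne (Metric.ediam s) 0 with hs0 | hs0
    · rw [hs0, ENNReal.zero_rpow_of_pos hd', nonpos_iff_eq_zero]
      have hlim : Tendsto (fun n : ℕ => ENNReal.ofReal (((m : ℝ)⁻¹) ^ n) ^ (d : ℝ)) atTop
          (𝓝 0) := by
        have h1 := ENNReal.tendsto_ofReal (tendsto_pow_atTop_nhds_zero_of_lt_one h0.le hl)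
        rw [ENNReal.ofReal_zero] at h1
        have h2 := (ENNReal.continuous_rpow_const (y := (d : ℝ))).tendsto 0
        rw [ENNReal.zero_rpow_of_pos hd'] at h2
        exact h2.comp h1
      refine nonpos_iff_eq_zero.1 (ge_of_tendsto hlim ?_)
      filter_upwards [eventually_ge_atTop N] with n hn
      refine hagree n (fun y hy => ?_) hn
      rw [(Metric.ediam_eq_zero_iff.1 hs0) hxs hy, dist_self]
      positivity
    · have hfin : Metric.ediam s ≠ ⊤ := (hs.trans_lt ENNReal.ofReal_lt_top).ne
      set r := (Metric.ediam s).toReal with hr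
      have hr0 : 0 < r := ENNReal.toReal_pos hs0 hfin
      have hrs : Metric.ediam s = ENNReal.ofReal r := (ENNReal.ofReal_toReal hfin).symm
      have hrN : r ≤ ((m : ℝ)⁻¹) ^ N := by
        rw [hrs] at hs
        exact (ENNReal.ofReal_le_ofReal_iff (by positivity)).1 hs
      -- For the least such `k`, `s` still lies in a cylinder of length `k`, because distances take
      -- only the values `m ^ (-n)` and `0`. Thus no constant is lost.
      have hex : ∃ k : ℕ, ((m : ℝ)⁻¹) ^ k ≤ r := by
        obtain ⟨k, hk⟩ := exists_pow_lt_of_lt_one hr0 hl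
        exact ⟨k, hk.le⟩
      classical
      have hspec := Nat.find_spec hex
      refine (hagree (Nat.find hex) (fun y hy => ?_) ?_).trans ?_
      · have hdist : dist x y ≤ r := by
          have := Metric.edist_le_ediam_of_mem hxs hy
          rw [hrs, edist_dist] at this
          exact (ENNReal.ofReal_le_ofReal_iff hr0.le).1 this
        rw [dist_le_pow_iff hm]
        rcases hn : Nat.find hex with _ | n
        · intro k hk
          omega
        · rw [hn] at hspec
          exact (dist_le_iff hm hspec
            (not_le.1 (Nat.find_min hex (m := n) (by omega)))).1 hdist
      · exact (pow_le_pow_iff_right_of_lt_one₀ h0 hl).1 (hspec.trans hrN)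
      · rw [hrs]
        gcongr
  refine le_dimH_of_hausdorffMeasure_ne_zero fun h0 => hPA ?_
  have := key A
  rw [h0, Measure.restrict_apply_self, nonpos_iff_eq_zero] at this
  exact this

open Classical in
theorem card_mul_le_one (hm : 2 ≤ m) (P : Measure (SymbolicSpace m)) [IsProbabilityMeasure P]
    (n : ℕ) (c : ℝ≥0∞) :
    ((Finset.univ.filter fun w : Fin n → Fin m => c ≤ P (restr n ⁻¹' {w})).card : ℝ≥0∞) * c ≤
      1 := by
  rw [← nsmul_eq_mul, ← Finset.sum_const]
  calc _ ≤ ∑ w with c ≤ P (restr n ⁻¹' {w}), P (restr n ⁻¹' {w}) :=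
        Finset.sum_le_sum fun w hw => (Finset.mem_filter.1 hw).2
    _ = P (restr n ⁻¹' (Finset.univ.filter fun w : Fin n → Fin m => c ≤ P (restr n ⁻¹' {w}))) :=
        sum_measure_preimage_singleton _ fun w _ => measurableSet_restr_preimage hm n _
    _ ≤ 1 := prob_le_one

/-- An upper bound for the Hausdorff dimension through lower bounds for the measures of infinitely
many cylinders around every point. -/
theorem dimH_le_of_frequently_le_measure (hm : 2 ≤ m) {P : Measure (SymbolicSpace m)}
    [IsProbabilityMeasure P] {A : Set (SymbolicSpace m)} {d' d : ℝ≥0} (hd : d' < d)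
    (h : ∀ x ∈ A, ∃ᶠ n in atTop,
      ENNReal.ofReal (((m : ℝ)⁻¹) ^ n) ^ (d' : ℝ) ≤ P (restr n ⁻¹' {restr n x})) :
    dimH A ≤ d := by
  classical
  have hl : (m : ℝ)⁻¹ < 1 := inv_lt_one_of_one_lt₀ (by exact_mod_cast (by omega : 1 < m))
  have h0 : 0 < (m : ℝ)⁻¹ := by positivity
  set y : ℝ≥0∞ := ENNReal.ofReal ((m : ℝ)⁻¹) with hy
  have hy1 : y < 1 := by
    rw [hy, ← ENNReal.ofReal_one]
    exact (ENNReal.ofReal_lt_ofReal_iff one_pos).2 hl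
  have hy0 : y ≠ 0 := (ENNReal.ofReal_pos.2 h0).ne'
  have hyt : y ≠ ⊤ := ENNReal.ofReal_ne_top
  have hpow : ∀ n : ℕ, ENNReal.ofReal (((m : ℝ)⁻¹) ^ n) = y ^ n := fun n =>
    ENNReal.ofReal_pow h0.le n
  simp only [hpow] at h
  -- At most `y ^ (-n d')` words of length `n` are heavy, so their cylinders contribute at most `ρ ^
  -- n` to the `d`-dimensional covering sum.
  set ρ : ℝ≥0∞ := y ^ ((d : ℝ) - d') with hρ
  have hρ1 : ρ < 1 := ENNReal.rpow_lt_one hy1 (sub_pos.2 (by exact_mod_cast hd))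
  let W : (n : ℕ) → Finset (Fin n → Fin m) := fun n =>
    Finset.univ.filter fun w => (y ^ n) ^ (d' : ℝ) ≤ P (restr n ⁻¹' {w})
  have hfactor : ∀ n : ℕ, (y ^ n) ^ (d : ℝ) = (y ^ n) ^ (d' : ℝ) * ρ ^ n := by
    intro n
    rw [hρ, ← ENNReal.rpow_natCast, ← ENNReal.rpow_natCast, ← ENNReal.rpow_mul,
      ← ENNReal.rpow_mul, ← ENNReal.rpow_mul, ← ENNReal.rpow_add _ _ hy0 hyt]
    congr 1
    ring
  have hbound : Measure.hausdorffMeasure d A ≤ (1 - ρ)⁻¹ := by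
    -- The `K`-th cover consists of all heavy cylinders of length at least `K`; every point of `A`
    -- lies in one of them.
    have := Measure.hausdorffMeasure_le_liminf_tsum (X := SymbolicSpace m)
      (ι := fun K : ℕ => Σ n : ℕ, W (n + K)) (d := (d : ℝ)) A (l := atTop) (fun K => y ^ K)
      (ENNReal.tendsto_pow_atTop_nhds_zero_of_lt_one hy1)
      (fun K p => restr (p.1 + K) ⁻¹' {p.2.1}) (Eventually.of_forall fun K p => ?_)
      (Eventually.of_forall fun K x hx => ?_)
    · refine this.trans ?_
      refine (liminf_le_liminf (v := fun _ => (1 - ρ)⁻¹) (Eventually.of_forall fun K => ?_)).trans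
        (liminf_const _).le
      rw [ENNReal.tsum_sigma fun (n : ℕ) (w : W (n + K)) =>
        Metric.ediam (restr (n + K) ⁻¹' {w.1}) ^ (d : ℝ)]
      calc _ ≤ ∑' n : ℕ, ρ ^ n := by
            refine ENNReal.tsum_le_tsum fun n => ?_
            calc _ ≤ ∑' _ : W (n + K), (y ^ (n + K)) ^ (d : ℝ) := by
                  refine ENNReal.tsum_le_tsum fun w => ?_
                  refine ENNReal.rpow_le_rpow ?_ d.2
                  rw [← hpow]
                  exact ediam_restr_preimage_le hm _ _
              _ = (W (n + K)).card * (y ^ (n + K)) ^ (d' : ℝ) * ρ ^ (n + K) := by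
                  rw [tsum_fintype, Finset.sum_const, nsmul_eq_mul, hfactor, ← mul_assoc]
                  simp
              _ ≤ 1 * ρ ^ (n + K) := by
                  gcongr
                  exact card_mul_le_one hm P (n + K) _
              _ ≤ ρ ^ n := by
                  rw [one_mul]
                  exact pow_le_pow_of_le_one zero_le hρ1.le (Nat.le_add_right n K)
        _ = (1 - ρ)⁻¹ := ENNReal.tsum_geometric ρ
    · refine (ediam_restr_preimage_le hm _ _).trans ?_
      rw [hpow]
      exact pow_le_pow_of_le_one zero_le hy1.le (Nat.le_add_left K p.1)
    · obtain ⟨n, hn, hnx⟩ := frequently_atTop.1 (h x hx) K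
      obtain ⟨k, rfl⟩ := Nat.exists_eq_add_of_le' hn
      exact Set.mem_iUnion.2 ⟨⟨k, restr (k + K) x, by simpa [W] using hnx⟩, rfl⟩
  refine dimH_le_of_hausdorffMeasure_ne_top (hbound.trans_lt ?_).ne
  rw [ENNReal.inv_lt_top]
  exact tsub_pos_of_lt hρ1

end SymbolicSpace

/-! ### Tree-indexed Markov chains -/

namespace SymbolicSpace

open MeasureTheory ProbabilityTheory

variable {m : ℕ}

/-- The word of length `ℓ` obtained by successively appending the letter that `η` assigns to the
current word. -/
def pathWord (η : List (Fin m) → Fin m) : ℕ → List (Fin m)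
  | 0 => []
  | ℓ + 1 => pathWord η ℓ ++ [η (pathWord η ℓ)]

/-- The infinite path that follows the choices of `η`. -/
def path (η : List (Fin m) → Fin m) : SymbolicSpace m := fun ℓ => η (pathWord η ℓ)

theorem take_path (η : List (Fin m) → Fin m) (ℓ : ℕ) : take (path η) ℓ = pathWord η ℓ := by
  induction ℓ with
  | zero => rfl
  | succ ℓ ih => rw [take_succ, ih]; rfl

theorem path_apply (η : List (Fin m) → Fin m) (ℓ : ℕ) : path η ℓ = η (take (path η) ℓ) := by
  rw [take_path]; rfl

theorem take_path_eq_iff (η : List (Fin m) → Fin m) (y : SymbolicSpace m) (L : ℕ) :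
    take (path η) L = take y L ↔ ∀ ℓ < L, η (take y ℓ) = y ℓ := by
  induction L with
  | zero => simp
  | succ L ih =>
    rw [take_succ, take_succ, List.append_singleton_inj, ih, Nat.forall_lt_succ_right, ← ih]
    refine and_congr_right fun h => ?_
    rw [path_apply, h]

theorem measurableSet_take_path_eq (ℓ : ℕ) (w : List (Fin m)) :
    MeasurableSet {η : List (Fin m) → Fin m | take (path η) ℓ = w} := by
  simp only [take_path]
  induction ℓ generalizing w with
  | zero =>
    simp only [pathWord]
    exact MeasurableSet.const _
  | succ ℓ ih =>
    have : {η : List (Fin m) → Fin m | pathWord η (ℓ + 1) = w} =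
        ⋃ v, ({η | pathWord η ℓ = v} ∩ {η | v ++ [η v] = w}) := by
      ext η
      simp [pathWord]
    rw [this]
    refine MeasurableSet.iUnion fun v => (ih v).inter ?_
    exact measurable_pi_apply v (MeasurableSet.of_discrete (s := {c | v ++ [c] = w}))

theorem measurable_comp_take_path {β : Type*} [MeasurableSpace β] (g : List (Fin m) → β) (ℓ : ℕ) :
    Measurable fun η : List (Fin m) → Fin m => g (take (path η) ℓ) := by
  intro s _
  have : (fun η : List (Fin m) → Fin m => g (take (path η) ℓ)) ⁻¹' s =
      ⋃ w ∈ g ⁻¹' s, {η | take (path η) ℓ = w} := by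
    ext η
    simp
  rw [this]
  exact MeasurableSet.biUnion (Set.to_countable _) fun w _ => measurableSet_take_path_eq ℓ w

/-- The law of independent choices at all the words. -/
noncomputable def choiceMeasure (p : List (Fin m) → PMF (Fin m)) :
    Measure (List (Fin m) → Fin m) :=
  Measure.infinitePi fun u => (p u).toMeasure

instance (p : List (Fin m) → PMF (Fin m)) : IsProbabilityMeasure (choiceMeasure p) := by
  unfold choiceMeasure
  infer_instance

/-- A path consults each word at most once, as lengths increase, so independent choices at the words
yield the Markov chain with transitions `p`. -/
theorem choiceMeasure_take_path (p : List (Fin m) → PMF (Fin m)) (y : SymbolicSpace m) (L : ℕ) :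
    choiceMeasure p {η | take (path η) L = take y L} =
      ∏ ℓ ∈ Finset.range L, p (take y ℓ) (y ℓ) := by
  classical
  have hinj : Function.Injective fun ℓ => take y ℓ := fun a b h => by
    simpa using congrArg List.length h
  -- The index `ℓ` is recovered from the word `take y ℓ` as its length, so the prescribed letter is
  -- `y u.length`.
  have : {η : List (Fin m) → Fin m | take (path η) L = take y L} =
      Set.pi ((Finset.range L).image fun ℓ => take y ℓ : Finset (List (Fin m)))
        fun u => {y u.length} := by
    ext η
    simp [take_path_eq_iff]
  rw [this, choiceMeasure, Measure.infinitePi_pi _ fun _ _ => MeasurableSet.of_discrete,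
    Finset.prod_image fun _ _ _ _ h => hinj h]
  refine Finset.prod_congr rfl fun ℓ _ => ?_
  rw [length_take, PMF.toMeasure_apply_singleton _ _ (MeasurableSet.of_discrete)]

/-- The law of independent choice functions for all the geometric progressions. -/
noncomputable def multiChoiceMeasure (p : List (Fin m) → PMF (Fin m)) :
    Measure (ℕ → List (Fin m) → Fin m) :=
  Measure.infinitePi fun _ => choiceMeasure p

instance (p : List (Fin m) → PMF (Fin m)) : IsProbabilityMeasure (multiChoiceMeasure p) := by
  unfold multiChoiceMeasure
  infer_instance

/-- The sequence whose subsequences along the geometric progressions are the paths of `ξ`. -/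
noncomputable def gluedPath (q : ℕ) (ξ : ℕ → List (Fin m) → Fin m) : SymbolicSpace m :=
  glue q fun i => path (ξ i)

theorem setOf_restr_gluedPath_eq {q : ℕ} (hq : 2 ≤ q) (n : ℕ) (x : SymbolicSpace m) :
    {ξ : ℕ → List (Fin m) → Fin m | restr n (gluedPath q ξ) = restr n x} =
      Set.pi ((Finset.Icc 1 n).filter (fun i => ¬ q ∣ i) : Finset ℕ) fun i =>
        {η | take (path η) (progLength q n i) = take (progSeq q i x) (progLength q n i)} := by
  ext ξ
  simp only [Set.mem_ofPred_eq, restr_eq_restr_iff_progSeq hq, Set.mem_pi, Finset.mem_coe]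
  refine forall₂_congr fun i hi => ?_
  rw [gluedPath, progSeq_glue hq (Finset.mem_filter.1 hi).2]

theorem measurableSet_restr_gluedPath {q : ℕ} (hq : 2 ≤ q) (n : ℕ) (w : Fin n → Fin m) :
    MeasurableSet {ξ : ℕ → List (Fin m) → Fin m | restr n (gluedPath q ξ) = w} := by
  by_cases h : ∃ x, restr n x = w
  · obtain ⟨x, rfl⟩ := h
    rw [setOf_restr_gluedPath_eq hq]
    exact MeasurableSet.pi (Finset.countable_toSet _) fun i _ => measurableSet_take_path_eq _ _
  · push Not at h
    convert MeasurableSet.empty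
    exact Set.eq_empty_of_forall_notMem fun ξ hξ => h _ hξ

theorem measurable_gluedPath (hm : 2 ≤ m) {q : ℕ} (hq : 2 ≤ q) :
    Measurable (gluedPath (m := m) q) := by
  refine measurable_of_isOpen fun U hU => ?_
  have : gluedPath q ⁻¹' U = ⋃ n : ℕ, ⋃ w ∈ {w : Fin n → Fin m | restr n ⁻¹' {w} ⊆ U},
      {ξ | restr n (gluedPath q ξ) = w} := by
    ext ξ
    simp only [Set.mem_preimage, Set.mem_iUnion, Set.mem_ofPred_eq, exists_prop]
    constructor
    · intro h
      obtain ⟨ε, hε, hU⟩ := Metric.isOpen_iff.1 hU _ h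
      obtain ⟨n, hn⟩ := exists_pow_lt_of_lt_one hε
        (inv_lt_one_of_one_lt₀ (by exact_mod_cast (by omega : 1 < m)) : (m : ℝ)⁻¹ < 1)
      refine ⟨n, _, fun x hx => hU ?_, rfl⟩
      exact ((dist_le_pow_iff hm).2 (restr_eq_restr_iff.1 hx)).trans_lt hn
    · rintro ⟨n, w, h, rfl⟩
      exact h rfl
  rw [this]
  exact MeasurableSet.iUnion fun n => MeasurableSet.biUnion (Set.to_countable _)
    fun w _ => measurableSet_restr_gluedPath hq n w

/-- The law of `gluedPath`. -/
noncomputable def gluedMeasure (q : ℕ) (p : List (Fin m) → PMF (Fin m)) :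
    Measure (SymbolicSpace m) :=
  (multiChoiceMeasure p).map (gluedPath q)

theorem isProbabilityMeasure_gluedMeasure (hm : 2 ≤ m) {q : ℕ} (hq : 2 ≤ q)
    (p : List (Fin m) → PMF (Fin m)) : IsProbabilityMeasure (gluedMeasure q p) :=
  Measure.isProbabilityMeasure_map (measurable_gluedPath hm hq).aemeasurable

theorem gluedMeasure_cylinder (hm : 2 ≤ m) {q : ℕ} (hq : 2 ≤ q) (p : List (Fin m) → PMF (Fin m))
    (n : ℕ) (x : SymbolicSpace m) :
    gluedMeasure q p (restr n ⁻¹' {restr n x}) =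
      ∏ i ∈ Finset.Icc 1 n with ¬ q ∣ i, ∏ ℓ ∈ Finset.range (progLength q n i),
        p (take (progSeq q i x) ℓ) (progSeq q i x ℓ) := by
  rw [gluedMeasure, Measure.map_apply (measurable_gluedPath hm hq)
    (measurableSet_restr_preimage hm n _)]
  change multiChoiceMeasure p {ξ | restr n (gluedPath q ξ) = restr n x} = _
  rw [setOf_restr_gluedPath_eq hq, multiChoiceMeasure, Measure.infinitePi_pi _
    fun i _ => measurableSet_take_path_eq _ _]
  exact Finset.prod_congr rfl fun i _ => choiceMeasure_take_path p _ _

theorem measurableSet_multiplicativeSubshift (hm : 2 ≤ m) {q : ℕ} (hq : 2 ≤ q)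
    {Ω : Set (SymbolicSpace m)} (hΩ : IsClosed Ω) :
    MeasurableSet (multiplicativeSubshift q Ω) := by
  have : multiplicativeSubshift q Ω =
      ⋂ i : {i : ℕ // ¬ q ∣ i}, ⋂ k : ℕ, {x | take (progSeq q i x) k ∈ prefixes Ω} := by
    ext x
    simp only [mem_multiplicativeSubshift_iff, Set.mem_iInter, Set.mem_ofPred_eq, Subtype.forall]
    exact forall₂_congr fun i hi => ⟨fun h k => take_mem_prefixes h k,
      fun h => mem_of_take_mem_prefixes hm hΩ h⟩
  rw [this]
  refine MeasurableSet.iInter fun i => MeasurableSet.iInter fun k =>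
    (isOpen_of_restr hm (i * q ^ k) fun x y h hx => ?_).measurableSet
  have heq : take (progSeq q i x) k = take (progSeq q i y) k := by
    refine take_eq_take_iff.2 fun ℓ hℓ => restr_eq_restr_iff.1 h _ ?_
    have h1 := pow_pos_of_not_dvd hq i.2 ℓ
    have h2 : (i : ℕ) * q ^ ℓ ≤ i * q ^ k :=
      Nat.mul_le_mul_left _ (Nat.pow_le_pow_right (by omega) hℓ.le)
    omega
  rw [Set.mem_ofPred_eq, ← heq]
  exact hx

/-- There are only countably many pairs of a progression and a word, so almost surely no forbidden
letter is ever chosen; closedness then puts the infinite paths in `Ω`. -/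
theorem ae_mem_multiplicativeSubshift (hm : 2 ≤ m) {q : ℕ} (hq : 2 ≤ q)
    {Ω : Set (SymbolicSpace m)} (hΩ : IsClosed Ω) (hne : Ω.Nonempty)
    {p : List (Fin m) → PMF (Fin m)}
    (hp : ∀ u ∈ prefixes Ω, ∀ c, u ++ [c] ∉ prefixes Ω → p u c = 0) :
    ∀ᵐ ξ ∂multiChoiceMeasure p, gluedPath q ξ ∈ multiplicativeSubshift q Ω := by
  have h1 : ∀ᵐ ξ ∂multiChoiceMeasure p, ∀ i, ∀ u ∈ prefixes Ω, u ++ [ξ i u] ∈ prefixes Ω := by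
    rw [ae_all_iff]
    intro i
    refine (measurePreserving_eval_infinitePi (fun _ => choiceMeasure p) i).quasiMeasurePreserving.ae
      (p := fun η => ∀ u ∈ prefixes Ω, u ++ [η u] ∈ prefixes Ω) ?_
    rw [ae_all_iff]
    intro u
    refine (measurePreserving_eval_infinitePi
      (fun u => (p u).toMeasure) u).quasiMeasurePreserving.ae
      (p := fun c => u ∈ prefixes Ω → u ++ [c] ∈ prefixes Ω) ?_
    by_cases hu : u ∈ prefixes Ω
    · rw [ae_iff, PMF.toMeasure_apply_eq_zero_iff _ MeasurableSet.of_discrete,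
        Set.disjoint_left]
      intro c hc hc'
      simp only [hu, true_imp_iff, Set.mem_ofPred_eq] at hc'
      exact hc (hp u hu c hc')
    · exact Eventually.of_forall fun c h => absurd h hu
  filter_upwards [h1] with ξ hξ
  refine glue_mem_multiplicativeSubshift hq fun i _ => mem_of_take_mem_prefixes hm hΩ fun k => ?_
  induction k with
  | zero => exact nil_mem_prefixes hne
  | succ k ih =>
    rw [take_succ, path_apply]
    exact hξ i _ ih

/-- The law of large numbers along the geometric progressions. -/
theorem ae_tendsto_average {q : ℕ} (hq : 2 ≤ q) (p : List (Fin m) → PMF (Fin m))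
    (g : List (Fin m) → ℝ) (C : ℝ) (hg : ∀ u, |g u| ≤ C) :
    ∃ D : ℝ, ∀ᵐ ξ ∂multiChoiceMeasure p, Tendsto (fun n : ℕ => (∑ j ∈ Finset.Icc 1 n,
      g (take (progSeq q (GeomProg.root q j) (gluedPath q ξ)) (GeomProg.depth q j + 1))) / n)
        atTop (𝓝 D) := by
  let Z : ℕ → ℕ → (ℕ → List (Fin m) → Fin m) → ℝ := fun i ℓ ξ => g (take (path (ξ i)) (ℓ + 1))
  let z : ℕ → ℝ := fun ℓ => ∫ η, g (take (path η) (ℓ + 1)) ∂choiceMeasure p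
  have hmeas : ∀ ℓ, Measurable fun η : List (Fin m) → Fin m => g (take (path η) (ℓ + 1)) :=
    fun ℓ => measurable_comp_take_path g _
  have hpres := fun i => measurePreserving_eval_infinitePi (fun _ : ℕ => choiceMeasure p) i
  -- Stated along any injection `e`, since the average over non-multiples of `q` needs the law both
  -- for all indices and for the multiples of `q`.
  have slln : ∀ ℓ, ∀ e : ℕ → ℕ, Function.Injective e → ∀ᵐ ξ ∂multiChoiceMeasure p,
      Tendsto (fun n : ℕ => (∑ i ∈ Finset.range n, Z (e i) ℓ ξ) / n) atTop (𝓝 (z ℓ)) := by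
    intro ℓ e he
    have hind : iIndepFun (fun i ξ => Z i ℓ ξ) (multiChoiceMeasure p) :=
      iIndepFun_infinitePi fun _ => hmeas ℓ
    have hZmeas : ∀ i, Measurable (Z i ℓ) := fun i => (hmeas ℓ).comp (measurable_pi_apply i)
    have hmap : ∀ i, (multiChoiceMeasure p).map (Z i ℓ) =
        (choiceMeasure p).map fun η => g (take (path η) (ℓ + 1)) := by
      intro i
      rw [← (hpres i).map_eq, Measure.map_map (hmeas ℓ) (hpres i).measurable]
      rfl
    have hint : Integrable (Z (e 0) ℓ) (multiChoiceMeasure p) :=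
      Integrable.of_bound (hZmeas _).aestronglyMeasurable C
        (Eventually.of_forall fun ξ => hg _)
    have := strong_law_ae_real (fun i => Z (e i) ℓ) hint
      (fun i j hij => hind.indepFun (he.ne hij))
      (fun i => ⟨(hZmeas _).aemeasurable, (hZmeas _).aemeasurable, by rw [hmap, hmap]⟩)
    have hz : ∫ ξ, Z (e 0) ℓ ξ ∂multiChoiceMeasure p = z ℓ := by
      simp only [z]
      rw [← (hpres (e 0)).map_eq, integral_map (hpres _).measurable.aemeasurable
        (hmeas ℓ).aestronglyMeasurable]
      rfl
    rwa [hz] at this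
  have hIcc : ∀ (f : ℕ → ℝ) (N : ℕ), ∑ i ∈ Finset.Icc 1 N, f i =
      ∑ i ∈ Finset.range N, f (i + 1) := by
    intro f N
    rw [Finset.range_eq_Ico, Finset.sum_Ico_add' f 0 N 1]
    rfl
  have h1 : ∀ᵐ ξ ∂multiChoiceMeasure p, ∀ ℓ,
      Tendsto (fun n : ℕ => (∑ i ∈ Finset.range n, Z (i + 1) ℓ ξ) / n) atTop (𝓝 (z ℓ)) :=
    ae_all_iff.2 fun ℓ => slln ℓ (fun i => i + 1) fun a b h => by simpa using h
  have h2 : ∀ᵐ ξ ∂multiChoiceMeasure p, ∀ ℓ,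
      Tendsto (fun n : ℕ => (∑ i ∈ Finset.range n, Z (q * (i + 1)) ℓ ξ) / n) atTop (𝓝 (z ℓ)) :=
    ae_all_iff.2 fun ℓ => slln ℓ (fun i => q * (i + 1)) fun a b h => by
      have := Nat.eq_of_mul_eq_mul_left (by omega) h
      omega
  refine ⟨∑' ℓ, (1 - (q : ℝ)⁻¹) * z ℓ / (q : ℝ) ^ ℓ, ?_⟩
  filter_upwards [h1, h2] with ξ h1 h2
  have := GeomProg.tendsto_average hq (fun i ℓ => Z i ℓ ξ) C (fun i ℓ => hg _) _ fun ℓ =>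
    GeomProg.tendsto_average_not_dvd hq (fun i => Z i ℓ ξ) (z ℓ)
      ((h1 ℓ).congr fun N => by rw [hIcc]) ((h2 ℓ).congr fun N => by rw [hIcc])
  refine this.congr fun n => ?_
  congr 1
  refine Finset.sum_congr rfl fun j hj => ?_
  simp only [Z]
  rw [gluedPath, progSeq_glue hq (GeomProg.not_dvd_root hq (Finset.mem_Icc.1 hj).1)]

end SymbolicSpace

/-! ### The Hausdorff dimension of multiplicative subshifts -/

/-- The power-sum equation says exactly that these weights add up to one. Outside `T` a point mass
is a dummy value. -/
theorem IsPowerSumFun.exists_transition {α : Type*} [Fintype α] {T : Set (List α)} {B : ℝ} {q : ℕ}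
    {τ : List α → ℝ} (hτ : IsPowerSumFun T B q τ) (hT : IsPrunedTree T) :
    ∃ p : List α → PMF α, ∀ u ∈ T, ∀ c, p u c = ENNReal.ofReal (τ (u ++ [c]) / τ u ^ q) := by
  obtain ⟨c₀, -⟩ := hT.exists_append [] hT.nil_mem
  have : ∀ u, ∃ p : PMF α, u ∈ T → ∀ c, p c = ENNReal.ofReal (τ (u ++ [c]) / τ u ^ q) := by
    intro u
    by_cases hu : u ∈ T
    · refine ⟨PMF.ofFintype (fun c => ENNReal.ofReal (τ (u ++ [c]) / τ u ^ q)) ?_,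
        fun _ c => rfl⟩
      have h1 : τ u ^ q ≠ 0 := (pow_pos (zero_lt_one.trans_le (hτ.one_le u hu)) q).ne'
      rw [← ENNReal.ofReal_sum_of_nonneg fun c _ => div_nonneg (hτ.nonneg _)
        (pow_nonneg (hτ.nonneg u) q), ← Finset.sum_div, ← hτ.pow_eq u hu, div_self h1,
        ENNReal.ofReal_one]
    · exact ⟨PMF.pure c₀, fun h => absurd h hu⟩
  choose p hp using this
  exact ⟨p, hp⟩

/-- Outside `T` this rests on the convention `Real.log 0 = 0`. -/
theorem IsPowerSumFun.log_nonneg {α : Type*} [Fintype α] {T : Set (List α)} {B : ℝ} {q : ℕ}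
    {τ : List α → ℝ} (hτ : IsPowerSumFun T B q τ) (u : List α) : 0 ≤ Real.log (τ u) := by
  by_cases hu : u ∈ T
  · exact Real.log_nonneg (hτ.one_le u hu)
  · rw [hτ.eq_zero u hu, Real.log_zero]

theorem IsPowerSumFun.log_le {α : Type*} [Fintype α] {T : Set (List α)} {B : ℝ} {q : ℕ}
    {τ : List α → ℝ} (hτ : IsPowerSumFun T B q τ) (hT : IsPrunedTree T) (u : List α) :
    Real.log (τ u) ≤ Real.log B := by
  by_cases hu : u ∈ T
  · exact Real.log_le_log (zero_lt_one.trans_le (hτ.one_le u hu)) (hτ.le_bound u hu)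
  · rw [hτ.eq_zero u hu, Real.log_zero]
    exact Real.log_nonneg (hτ.one_le_bound hT)

/-- If the sequence eventually dropped by more than `ε` at each step, it would become negative. -/
theorem frequently_sub_succ_le {a : ℕ → ℝ} (ha : ∀ k, 0 ≤ a k) {ε : ℝ} (hε : 0 < ε) :
    ∃ᶠ k in atTop, a k - a (k + 1) ≤ ε := by
  intro h
  obtain ⟨K, hK⟩ := eventually_atTop.1 h
  have key : ∀ n : ℕ, a (K + n) ≤ a K - n * ε := by
    intro n
    induction n with
    | zero => simp
    | succ n ih =>
      have := not_le.1 (hK (K + n) (Nat.le_add_right K n))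
      rw [← add_assoc]
      push_cast
      linarith
  obtain ⟨n, hn⟩ := exists_nat_gt (a K / ε)
  rw [div_lt_iff₀ hε] at hn
  linarith [key n, ha (K + n)]

namespace SymbolicSpace

open MeasureTheory

variable {m : ℕ}

/-- The sum of the logarithms of `τ` over the words that end at the positions `1, …, n`. -/
noncomputable def logSum (q : ℕ) (τ : List (Fin m) → ℝ) (x : SymbolicSpace m) (n : ℕ) : ℝ :=
  ∑ j ∈ Finset.Icc 1 n,
    Real.log (τ (take (progSeq q (GeomProg.root q j) x) (GeomProg.depth q j + 1)))

/-- A position with word `u ++ [c]` contributes `log τ (u ++ [c]) - q * log τ u`. The first terms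
sum to `logSum` at `n`. In the second, `u` is empty at non-multiples of `q`, and at position `q * j`
it is the word ending at `j`, which yields `logSum` at `n / q`. -/
theorem gluedMeasure_cylinder_eq_exp (hm : 2 ≤ m) {q : ℕ} (hq : 2 ≤ q)
    {Ω : Set (SymbolicSpace m)} {B : ℝ} {τ : List (Fin m) → ℝ}
    (hτ : IsPowerSumFun (prefixes Ω) B q τ) {p : List (Fin m) → PMF (Fin m)}
    (hp : ∀ u ∈ prefixes Ω, ∀ c, p u c = ENNReal.ofReal (τ (u ++ [c]) / τ u ^ q))
    {x : SymbolicSpace m} (hx : x ∈ multiplicativeSubshift q Ω) (n : ℕ) :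
    gluedMeasure q p (restr n ⁻¹' {restr n x}) = ENNReal.ofReal (Real.exp
      (logSum q τ x n - q * logSum q τ x (n / q) - q * (n - (n / q : ℕ)) * Real.log (τ []))) := by
  rw [mem_multiplicativeSubshift_iff] at hx
  have hpos : ∀ i, ¬ q ∣ i → ∀ ℓ, 0 < τ (take (progSeq q i x) ℓ) := fun i hi ℓ =>
    zero_lt_one.trans_le (hτ.one_le _ (take_mem_prefixes (hx i hi) ℓ))
  have hsum : logSum q τ x n - q * logSum q τ x (n / q) -
      q * (n - (n / q : ℕ)) * Real.log (τ []) =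
      ∑ i ∈ Finset.Icc 1 n with ¬ q ∣ i, ∑ ℓ ∈ Finset.range (progLength q n i),
        (Real.log (τ (take (progSeq q i x) (ℓ + 1))) -
          q * Real.log (τ (take (progSeq q i x) ℓ))) := by
    rw [sum_root_depth_eq hq (fun i ℓ => Real.log (τ (take (progSeq q i x) (ℓ + 1))) -
      q * Real.log (τ (take (progSeq q i x) ℓ))), Finset.sum_sub_distrib, ← Finset.mul_sum,
      GeomProg.sum_Icc_eq_add hq (fun j =>
        Real.log (τ (take (progSeq q (GeomProg.root q j) x) (GeomProg.depth q j))))]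
    have h1 : ∑ j ∈ Finset.Icc 1 n with ¬ q ∣ j,
        Real.log (τ (take (progSeq q (GeomProg.root q j) x) (GeomProg.depth q j))) =
        (n - (n / q : ℕ)) * Real.log (τ []) := by
      rw [Finset.sum_congr rfl fun j hj => by
        rw [GeomProg.depth_eq_zero hq (Finset.mem_filter.1 hj).2, take_zero],
        Finset.sum_const, nsmul_eq_mul]
      congr 1
      rw [eq_sub_iff_add_eq]
      exact_mod_cast GeomProg.card_filter_not_dvd hq n
    have h2 : ∑ j ∈ Finset.Icc 1 (n / q), Real.log (τ (take
        (progSeq q (GeomProg.root q (q * j)) x) (GeomProg.depth q (q * j)))) =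
        logSum q τ x (n / q) := by
      refine Finset.sum_congr rfl fun j hj => ?_
      rw [Finset.mem_Icc] at hj
      rw [GeomProg.root_mul hq hj.1, GeomProg.depth_mul hq hj.1]
    rw [h1, h2, logSum]
    ring
  rw [gluedMeasure_cylinder hm hq, hsum, Real.exp_sum,
    ENNReal.ofReal_prod_of_nonneg fun _ _ => (Real.exp_pos _).le]
  refine Finset.prod_congr rfl fun i hi => ?_
  have hi' := (Finset.mem_filter.1 hi).2
  rw [Real.exp_sum, ENNReal.ofReal_prod_of_nonneg fun _ _ => (Real.exp_pos _).le]
  refine Finset.prod_congr rfl fun ℓ _ => ?_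
  rw [hp _ (take_mem_prefixes (hx i hi') ℓ), ← take_succ, Real.exp_sub, Real.exp_nat_mul,
    Real.exp_log (hpos i hi' _), Real.exp_log (hpos i hi' _)]

theorem ofReal_inv_pow_rpow (hm : 2 ≤ m) (n : ℕ) (d : ℝ) :
    ENNReal.ofReal (((m : ℝ)⁻¹) ^ n) ^ d =
      ENNReal.ofReal (Real.exp (-(n * (d * Real.log m)))) := by
  have h0 : 0 < (m : ℝ)⁻¹ := by positivity
  rw [ENNReal.ofReal_rpow_of_pos (by positivity), Real.rpow_def_of_pos (by positivity),
    Real.log_pow, Real.log_inv]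
  congr 2
  ring

theorem logSum_nonneg {q : ℕ} {Ω : Set (SymbolicSpace m)} {B : ℝ} {τ : List (Fin m) → ℝ}
    (hτ : IsPowerSumFun (prefixes Ω) B q τ) (x : SymbolicSpace m) (n : ℕ) :
    0 ≤ logSum q τ x n :=
  Finset.sum_nonneg fun _ _ => hτ.log_nonneg _

theorem dimH_multiplicativeSubshift_le (hm : 2 ≤ m) {q : ℕ} (hq : 2 ≤ q)
    {Ω : Set (SymbolicSpace m)} (hne : Ω.Nonempty) {B : ℝ} {τ : List (Fin m) → ℝ}
    (hτ : IsPowerSumFun (prefixes Ω) B q τ) :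
    dimH (multiplicativeSubshift q Ω) ≤
      ENNReal.ofReal (((q : ℝ) - 1) * Real.logb m (τ [])) := by
  have hT := isPrunedTree_prefixes hne
  have hm1 : (1 : ℝ) < m := by exact_mod_cast (by omega : 1 < m)
  have hq1 : (1 : ℝ) < q := by exact_mod_cast (by omega : 1 < q)
  have hlm := Real.log_pos hm1
  obtain ⟨p, hp⟩ := hτ.exists_transition hT
  have := isProbabilityMeasure_gluedMeasure hm hq p
  set s : ℝ := ((q : ℝ) - 1) * Real.logb m (τ []) with hs
  have hs0 : 0 ≤ s := mul_nonneg (by linarith)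
    (div_nonneg (hτ.log_nonneg _) hlm.le)
  have hsm : s * Real.log m = (q - 1) * Real.log (τ []) := by
    rw [hs, Real.logb]
    field_simp
  refine ENNReal.le_of_forall_pos_le_add fun ε hε _ => ?_
  rw [ENNReal.ofReal, ← ENNReal.coe_add]
  have hε' : (0 : ℝ) < ε := hε
  refine dimH_le_of_frequently_le_measure hm (P := gluedMeasure q p)
    (d' := s.toNNReal + ε / 2) (by gcongr; exact NNReal.half_lt_self hε.ne') fun x hx => ?_
  have hcoe : ((s.toNNReal + ε / 2 : ℝ≥0) : ℝ) = s + ε / 2 := by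
    push_cast
    rw [Real.coe_toNNReal s hs0]
  rw [hcoe]
  -- At lengths `q ^ (k + 1)` the floor is exact, and the two `logSum` terms form `q ^ (k + 1)`
  -- times a consecutive difference of averages.
  have hfreq := frequently_sub_succ_le (a := fun k : ℕ => logSum q τ x (q ^ k) / (q : ℝ) ^ k)
    (fun k => div_nonneg (logSum_nonneg hτ x _) (by positivity))
    (show 0 < ε / 2 * Real.log m by positivity)
  have htend : Tendsto (fun k : ℕ => q ^ (k + 1)) atTop atTop :=
    (tendsto_pow_atTop_atTop_of_one_lt (by omega)).comp (tendsto_add_atTop_nat 1)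
  refine htend.frequently (hfreq.mono fun k hk => ?_)
  rw [ofReal_inv_pow_rpow hm, gluedMeasure_cylinder_eq_exp hm hq hτ hp hx]
  refine ENNReal.ofReal_le_ofReal (Real.exp_le_exp.2 ?_)
  have hdiv : q ^ (k + 1) / q = q ^ k := by
    rw [pow_succ, Nat.mul_div_cancel _ (by omega)]
  rw [hdiv]
  push_cast
  have hqk : (0 : ℝ) < (q : ℝ) ^ (k + 1) := by positivity
  have h1 := mul_le_mul_of_nonneg_left hk hqk.le
  have h2 : (q : ℝ) ^ (k + 1) * (logSum q τ x (q ^ k) / (q : ℝ) ^ k -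
      logSum q τ x (q ^ (k + 1)) / (q : ℝ) ^ (k + 1)) =
      q * logSum q τ x (q ^ k) - logSum q τ x (q ^ (k + 1)) := by
    rw [pow_succ]
    field_simp
  rw [h2] at h1
  rw [add_mul, hsm]
  rw [pow_succ (q : ℝ)] at h1 ⊢
  linarith

theorem le_dimH_multiplicativeSubshift (hm : 2 ≤ m) {q : ℕ} (hq : 2 ≤ q)
    {Ω : Set (SymbolicSpace m)} (hclosed : IsClosed Ω) (hne : Ω.Nonempty) {B : ℝ}
    {τ : List (Fin m) → ℝ} (hτ : IsPowerSumFun (prefixes Ω) B q τ) :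
    ENNReal.ofReal (((q : ℝ) - 1) * Real.logb m (τ [])) ≤
      dimH (multiplicativeSubshift q Ω) := by
  have hT := isPrunedTree_prefixes hne
  have hm1 : (1 : ℝ) < m := by exact_mod_cast (by omega : 1 < m)
  have hlm := Real.log_pos hm1
  obtain ⟨p, hp⟩ := hτ.exists_transition hT
  have := isProbabilityMeasure_gluedMeasure hm hq p
  refine ENNReal.le_of_forall_nnreal_lt fun d hd => ?_
  rcases eq_or_ne d 0 with rfl | hd0
  · exact zero_le
  have hd' : (d : ℝ) * Real.log m < (q - 1) * Real.log (τ []) := by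
    rw [ENNReal.ofReal, ENNReal.coe_lt_coe, Real.lt_toNNReal_iff_coe_lt, Real.logb,
      ← mul_div_assoc, lt_div_iff₀ hlm] at hd
    exact hd
  have hX := measurableSet_multiplicativeSubshift hm hq hclosed
  set c : ℕ → ℝ≥0∞ := fun n => ENNReal.ofReal (((m : ℝ)⁻¹) ^ n) ^ (d : ℝ) with hc
  -- The points where the measure bound holds from length `N` on. Their union has full measure, so
  -- some `A N` is not null and the bound there is uniform.
  let A : ℕ → Set (SymbolicSpace m) := fun N => multiplicativeSubshift q Ω ∩
    ⋂ n : ℕ, ⋂ _ : N ≤ n, {x | gluedMeasure q p (restr n ⁻¹' {restr n x}) ≤ c n}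
  have hA : ∀ N, MeasurableSet (A N) := fun N =>
    hX.inter (MeasurableSet.iInter fun n => MeasurableSet.iInter fun _ =>
      measurableSet_restr_preimage hm n {w | gluedMeasure q p (restr n ⁻¹' {w}) ≤ c n})
  have hae : ∀ᵐ x ∂gluedMeasure q p, x ∈ ⋃ N, A N := by
    rw [gluedMeasure, ae_map_iff (p := fun x => x ∈ ⋃ N, A N)
      (measurable_gluedPath hm hq).aemeasurable (MeasurableSet.iUnion hA)]
    obtain ⟨D, hD⟩ := ae_tendsto_average hq p (fun u => Real.log (τ u)) (Real.log B) fun u => by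
      rw [abs_of_nonneg (hτ.log_nonneg u)]
      exact hτ.log_le hT u
    have hsupp := ae_mem_multiplicativeSubshift hm hq hclosed hne (p := p) fun u hu c hc => by
      rw [hp u hu, hτ.eq_zero _ hc, zero_div, ENNReal.ofReal_zero]
    filter_upwards [hD, hsupp] with ξ hξ hmem
    have h3 : Tendsto (fun n : ℕ => n / q) atTop atTop :=
      Nat.tendsto_div_const_atTop (by positivity)
    have h4 : Tendsto (fun n : ℕ => ((n / q : ℕ) : ℝ) / n) atTop (𝓝 (q : ℝ)⁻¹) :=
      GeomProg.tendsto_natDiv_div q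
    change Tendsto (fun n : ℕ => logSum q τ (gluedPath q ξ) n / n) atTop (𝓝 D) at hξ
    have hlim : Tendsto (fun n : ℕ => logSum q τ (gluedPath q ξ) n / n -
        q * (((n / q : ℕ) : ℝ) / n * (logSum q τ (gluedPath q ξ) (n / q) / (n / q : ℕ))) -
        q * (1 - ((n / q : ℕ) : ℝ) / n) * Real.log (τ [])) atTop
        (𝓝 (-((q - 1) * Real.log (τ [])))) := by
      have := (hξ.sub ((h4.mul (hξ.comp h3)).const_mul (q : ℝ))).sub
        (((h4.const_sub 1).const_mul (q : ℝ)).mul_const (Real.log (τ [])))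
      have hq0 : (q : ℝ) ≠ 0 := by positivity
      -- The unknown limit `D` cancels, so its value is never needed.
      have hval : D - q * ((q : ℝ)⁻¹ * D) - q * (1 - (q : ℝ)⁻¹) * Real.log (τ []) =
          -((q - 1) * Real.log (τ [])) := by
        field_simp
        ring
      rw [hval] at this
      exact this
    obtain ⟨N, hN⟩ := eventually_atTop.1 ((hlim.eventually_lt_const (neg_lt_neg hd')).and
      (eventually_gt_atTop 0))
    refine Set.mem_iUnion.2 ⟨N, hmem, Set.mem_iInter₂.2 fun n hn => ?_⟩
    obtain ⟨hlt, hn0⟩ := hN n hn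
    rw [Set.mem_ofPred_eq, hc]
    simp only
    rw [ofReal_inv_pow_rpow hm, gluedMeasure_cylinder_eq_exp hm hq hτ hp hmem]
    refine ENNReal.ofReal_le_ofReal (Real.exp_le_exp.2 ?_)
    have hn0' : (0 : ℝ) < n := by exact_mod_cast hn0
    have h5 := mul_le_mul_of_nonneg_left hlt.le hn0'.le
    refine le_trans (le_of_eq ?_) (h5.trans (le_of_eq (by ring)))
    rcases Nat.eq_zero_or_pos (n / q) with h | h
    · rw [h]
      have : logSum q τ (gluedPath q ξ) 0 = 0 := by simp [logSum]
      rw [this]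
      field_simp
      simp
    · have : ((n / q : ℕ) : ℝ) ≠ 0 := by positivity
      field_simp
  have hpos : ∃ N, gluedMeasure q p (A N) ≠ 0 := by
    by_contra! h0
    have h1 : gluedMeasure q p (⋃ N, A N) = 0 := measure_iUnion_null h0
    have h2 : gluedMeasure q p (⋃ N, A N) = 1 := mem_ae_iff_prob_eq_one (MeasurableSet.iUnion hA) |>.1 hae
    rw [h1] at h2
    exact zero_ne_one h2
  obtain ⟨N, hN⟩ := hpos
  refine (le_dimH_of_measure_le hm (hA N) hN (pos_iff_ne_zero.2 hd0) N fun x hx n hn => ?_).trans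
    (dimH_mono Set.inter_subset_left)
  exact Set.mem_iInter₂.1 hx.2 n hn

end SymbolicSpace

/-! ### Power-sum vectors on the tree of prefixes -/

namespace SymbolicSpace

variable {m : ℕ}

open Classical in
/-- Extension by zero of a function on the prefixes to all words. -/
noncomputable def extendByZero {Ω : Set (SymbolicSpace m)} (t : prefixes Ω → ℝ)
    (u : List (Fin m)) : ℝ :=
  if h : u ∈ prefixes Ω then t ⟨u, h⟩ else 0

theorem extendByZero_coe {Ω : Set (SymbolicSpace m)} (t : prefixes Ω → ℝ) (v : prefixes Ω) :
    extendByZero t v = t v := by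
  rw [extendByZero, dif_pos v.2]

theorem extendByZero_of_notMem {Ω : Set (SymbolicSpace m)} (t : prefixes Ω → ℝ)
    {u : List (Fin m)} (hu : u ∉ prefixes Ω) : extendByZero t u = 0 := by
  rw [extendByZero, dif_neg hu]

theorem finsum_adj_eq {Ω : Set (SymbolicSpace m)} (t : prefixes Ω → ℝ) (v : prefixes Ω) :
    ∑ᶠ (w : prefixes Ω) (_ : (prefixTree Ω).Adj v w), t w =
      ∑ c, extendByZero t ((v : List (Fin m)) ++ [c]) := by
  classical
  let S : Type := {c : Fin m // (v : List (Fin m)) ++ [c] ∈ prefixes Ω}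
  let g : S → prefixes Ω := fun c => ⟨v ++ [c.1], c.2⟩
  have hg : Function.Injective g := fun a b h => by
    have := congrArg Subtype.val h
    simp only [g, List.append_cancel_left_eq, List.cons.injEq, and_true] at this
    exact Subtype.ext this
  have hr : ∀ w, (prefixTree Ω).Adj v w ↔ w ∈ Set.range g := fun w =>
    ⟨fun ⟨c, hc⟩ => ⟨⟨c, hc ▸ w.2⟩, Subtype.ext hc.symm⟩,
      fun ⟨c, hc⟩ => ⟨c.1, by rw [← hc]⟩⟩
  simp only [hr]
  rw [finsum_mem_range hg, finsum_eq_sum_of_fintype]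
  symm
  rw [← Finset.sum_filter_of_ne (p := fun c => (v : List (Fin m)) ++ [c] ∈ prefixes Ω)
    fun c _ h => by_contra fun hc => h (extendByZero_of_notMem t hc),
    ← Finset.sum_subtype_of_mem (p := fun c => (v : List (Fin m)) ++ [c] ∈ prefixes Ω) _
      fun c hc => (Finset.mem_filter.1 hc).2]
  refine Finset.sum_congr ?_ fun c _ => ?_
  · ext c
    simpa using c.2
  · exact extendByZero_coe t (g c)

theorem isPowerSumVector_iff {q : ℕ} {Ω : Set (SymbolicSpace m)} {t : prefixes Ω → ℝ} :
    IsPowerSumVector (prefixTree Ω) m q t ↔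
      IsPowerSumFun (prefixes Ω) ((m : ℝ) ^ (1 / ((q : ℝ) - 1))) q (extendByZero t) := by
  constructor
  · rintro ⟨h1, h2⟩
    refine ⟨fun u hu => ?_, fun u hu => ?_, fun u hu => extendByZero_of_notMem t hu,
      fun u hu => ?_⟩
    · exact (h1 ⟨u, hu⟩).1.trans_eq (extendByZero_coe t ⟨u, hu⟩).symm
    · exact (extendByZero_coe t ⟨u, hu⟩).le.trans (h1 ⟨u, hu⟩).2
    · have := h2 ⟨u, hu⟩
      rwa [finsum_adj_eq, ← extendByZero_coe t ⟨u, hu⟩] at this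
  · intro h
    refine ⟨fun v => ⟨?_, ?_⟩, fun v => ?_⟩
    · rw [← extendByZero_coe t v]
      exact h.one_le v v.2
    · rw [← extendByZero_coe t v]
      exact h.le_bound v v.2
    · rw [finsum_adj_eq, ← extendByZero_coe t v]
      exact h.pow_eq v v.2

theorem existsUnique_isPowerSumVector (hm : 2 ≤ m) {q : ℕ} (hq : 2 ≤ q)
    {Ω : Set (SymbolicSpace m)} (hne : Ω.Nonempty) :
    ∃! t : prefixes Ω → ℝ, IsPowerSumVector (prefixTree Ω) m q t := by
  have hT := isPrunedTree_prefixes hne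
  have hm1 : (1 : ℝ) < m := by exact_mod_cast (by omega : 1 < m)
  have hq1 : (0 : ℝ) < (q : ℝ) - 1 := sub_pos.2 (by exact_mod_cast (by omega : 1 < q))
  have hB : (1 : ℝ) ≤ (m : ℝ) ^ (1 / ((q : ℝ) - 1)) := Real.one_le_rpow hm1.le (by positivity)
  -- The exponents agree because `q / (q - 1) = 1 + 1 / (q - 1)`.
  have hBq : ((m : ℝ) ^ (1 / ((q : ℝ) - 1))) ^ q =
      Fintype.card (Fin m) * (m : ℝ) ^ (1 / ((q : ℝ) - 1)) := by
    rw [Fintype.card_fin, ← Real.rpow_natCast, ← Real.rpow_mul (by positivity)]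
    nth_rewrite 2 [← Real.rpow_one (m : ℝ)]
    rw [← Real.rpow_add (by positivity)]
    congr 1
    field_simp
    ring
  obtain ⟨τ, hτ⟩ := hT.exists_isPowerSumFun hq hB hBq
  have hext : extendByZero (fun v : prefixes Ω => τ v) = τ := by
    funext u
    by_cases hu : u ∈ prefixes Ω
    · exact extendByZero_coe _ ⟨u, hu⟩
    · rw [extendByZero_of_notMem _ hu, hτ.eq_zero u hu]
  refine ⟨fun v => τ v, isPowerSumVector_iff.2 (by rw [hext]; exact hτ), fun t ht => funext fun v => ?_⟩
  rw [← extendByZero_coe t v, (isPowerSumVector_iff.1 ht).unique hT hq hτ]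

open Classical in
theorem isSphericallySymmetric_iff {Ω : Set (SymbolicSpace m)} :
    IsSphericallySymmetric Ω ↔
      ∀ u ∈ prefixes Ω, ∀ v ∈ prefixes Ω, u.length = v.length →
        (Finset.univ.filter fun c => u ++ [c] ∈ prefixes Ω).card =
          (Finset.univ.filter fun c => v ++ [c] ∈ prefixes Ω).card := by
  have key : ∀ (u : List (Fin m)) (k : ℕ), u.length = k →
      {i : Fin m | u ++ [i] ∈ prefixesOfLength Ω (k + 1)}.ncard =
        (Finset.univ.filter fun c => u ++ [c] ∈ prefixes Ω).card := by
    intro u k hk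
    rw [← Set.ncard_coe_finset]
    congr 1
    ext c
    simp [mem_prefixesOfLength_iff, hk]
  constructor
  · intro h u hu v hv huv
    have := h u.length u (mem_prefixesOfLength_iff.2 ⟨hu, rfl⟩) v
      (mem_prefixesOfLength_iff.2 ⟨hv, huv.symm⟩)
    rwa [key u _ rfl, key v _ huv.symm] at this
  · intro h k u hu v hv
    rw [mem_prefixesOfLength_iff] at hu hv
    rw [key u k hu.2, key v k hv.2]
    exact h u hu.1 v hv.1 (hu.2.trans hv.2.symm)

theorem multiplicativeSubshift_nonempty {q : ℕ} (hq : 2 ≤ q) {Ω : Set (SymbolicSpace m)}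
    (hne : Ω.Nonempty) : (multiplicativeSubshift q Ω).Nonempty := by
  obtain ⟨x, hx⟩ := hne
  exact ⟨glue q fun _ => x, glue_mem_multiplicativeSubshift hq fun _ _ => hx⟩

end SymbolicSpace

/-! ### The main theorem -/

theorem theorem2p2 (m q : ℕ) (hm : 2 ≤ m) (hq : 2 ≤ q) (Ω : Set (SymbolicSpace m))
    (hclosed : IsClosed Ω) (hne : Ω.Nonempty) :
    (∃! t : SymbolicSpace.prefixes Ω → ℝ,
        IsPowerSumVector (SymbolicSpace.prefixTree Ω) m q t) ∧
    (∀ t : SymbolicSpace.prefixes Ω → ℝ,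
        IsPowerSumVector (SymbolicSpace.prefixTree Ω) m q t →
        dimH (SymbolicSpace.multiplicativeSubshift q Ω) =
          ENNReal.ofReal (((q : ℝ) - 1) *
            Real.logb m (t ⟨[], SymbolicSpace.nil_mem_prefixes hne⟩))) ∧
    Summable (fun k : ℕ =>
        Real.logb m ((SymbolicSpace.prefixesOfLength Ω (k + 1)).ncard : ℝ) /
          (q : ℝ) ^ ((k + 1) + 1)) ∧
    HasMinkowskiDim (SymbolicSpace.multiplicativeSubshift q Ω)
      ((((q : ℝ) - 1) ^ 2 * ∑' k : ℕ,
        Real.logb m ((SymbolicSpace.prefixesOfLength Ω (k + 1)).ncard : ℝ) /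
          (q : ℝ) ^ ((k + 1) + 1) : ℝ) : EReal) ∧
    (HasMinkowskiDim (SymbolicSpace.multiplicativeSubshift q Ω)
        ((dimH (SymbolicSpace.multiplicativeSubshift q Ω) : ℝ≥0∞) : EReal) ↔
      SymbolicSpace.IsSphericallySymmetric Ω) := by
  have hT := SymbolicSpace.isPrunedTree_prefixes hne
  have hm1 : (1 : ℝ) < m := by exact_mod_cast (by omega : 1 < m)
  have hq1 : (1 : ℝ) < q := by exact_mod_cast (by omega : 1 < q)
  have hlm := Real.log_pos hm1
  set N : ℕ → ℝ := fun k => Real.log (IsPrunedTree.level (SymbolicSpace.prefixes Ω) k).card with hN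
  have hN0 : N 0 = 0 := by simp [hN, hT.level_zero]
  have hsum : Summable fun k => N k / (q : ℝ) ^ (k + 1) := hT.summable_log_card_level hq
  have hterm : ∀ k, Real.logb m ((SymbolicSpace.prefixesOfLength Ω (k + 1)).ncard : ℝ) /
      (q : ℝ) ^ ((k + 1) + 1) = N (k + 1) / (q : ℝ) ^ ((k + 1) + 1) / Real.log m := by
    intro k
    rw [SymbolicSpace.ncard_prefixesOfLength, Real.logb, div_right_comm]
  have hdim : ∀ t : SymbolicSpace.prefixes Ω → ℝ,
      IsPowerSumVector (SymbolicSpace.prefixTree Ω) m q t →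
      dimH (SymbolicSpace.multiplicativeSubshift q Ω) =
        ENNReal.ofReal (((q : ℝ) - 1) *
          Real.logb m (t ⟨[], SymbolicSpace.nil_mem_prefixes hne⟩)) := by
    intro t ht
    have hτ := SymbolicSpace.isPowerSumVector_iff.1 ht
    rw [← SymbolicSpace.extendByZero_coe t ⟨[], SymbolicSpace.nil_mem_prefixes hne⟩]
    exact le_antisymm (SymbolicSpace.dimH_multiplicativeSubshift_le hm hq hne hτ)
      (SymbolicSpace.le_dimH_multiplicativeSubshift hm hq hclosed hne hτ)
  -- The statement sums from `k = 1` while the lemmas sum from `k = 0`; the extra term is zero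
  -- because the only prefix of length `0` is `[]`.
  have hseries : ∑' k, N k / (q : ℝ) ^ (k + 1) = ∑' k, N (k + 1) / (q : ℝ) ^ ((k + 1) + 1) := by
    rw [hsum.tsum_eq_zero_add, hN0, zero_div, zero_add]
  have hmink : HasMinkowskiDim (SymbolicSpace.multiplicativeSubshift q Ω)
      ((((q : ℝ) - 1) ^ 2 * (∑' k, N k / (q : ℝ) ^ (k + 1)) / Real.log m : ℝ) : EReal) :=
    SymbolicSpace.hasMinkowskiDim_of_tendsto hm
      (SymbolicSpace.multiplicativeSubshift_nonempty hq hne)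
      (SymbolicSpace.tendsto_log_ncard_restr_image hq hne)
  refine ⟨SymbolicSpace.existsUnique_isPowerSumVector hm hq hne, hdim, ?_, ?_, ?_⟩
  · simp only [hterm]
    exact ((summable_nat_add_iff 1).2 hsum).div_const _
  · simp only [hterm]
    rw [tsum_div_const, ← hseries, ← mul_div_assoc]
    exact hmink
  · obtain ⟨t, ht, -⟩ := SymbolicSpace.existsUnique_isPowerSumVector hm hq hne
    have hτ := SymbolicSpace.isPowerSumVector_iff.1 ht
    have hnn : 0 ≤ ((q : ℝ) - 1) * Real.logb m (SymbolicSpace.extendByZero t []) :=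
      mul_nonneg (by linarith) (div_nonneg (hτ.log_nonneg _) hlm.le)
    rw [hdim t ht, ← SymbolicSpace.extendByZero_coe t ⟨[], SymbolicSpace.nil_mem_prefixes hne⟩,
      EReal.coe_ennreal_ofReal, max_eq_left hnn, SymbolicSpace.isSphericallySymmetric_iff,
      ← hτ.log_eq_iff hT hq]
    -- After cancelling one factor `q - 1` and `log m`, equality of the dimensions is the equality
    -- case of the gap series.
    have hiff : Real.log (SymbolicSpace.extendByZero t []) =
        ((q : ℝ) - 1) * ∑' k, N k / (q : ℝ) ^ (k + 1) ↔
        ((q : ℝ) - 1) ^ 2 * (∑' k, N k / (q : ℝ) ^ (k + 1)) / Real.log m =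
          ((q : ℝ) - 1) * Real.logb m (SymbolicSpace.extendByZero t []) := by
      have hq0 : (q : ℝ) - 1 ≠ 0 := by linarith
      rw [Real.logb, ← mul_div_assoc, div_left_inj' hlm.ne', pow_two, mul_assoc,
        mul_right_inj' hq0, eq_comm]
    rw [hiff]
    constructor
    · intro h
      exact_mod_cast hmink.1.symm.trans h.1
    · intro h
      rw [← h]
      exact hmink
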